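/- Let $K$ be a locally finitely presentable category, and let $L$ be a definable subcategory of $K$, i.e. a full subcategory closed in $K$ under small products, directed colimits and pure subobjects. Let $\mathrm{fp}\,K$ be the full subcategory of finitely presentable objects of $K$, and let $\mathcal M$ be the class of all morphisms $h\colon A\to B$ of $\mathrm{fp}\,K$ such that every object $X$ of $L$ is injective with respect to $h$ (every $A\to X$ factors through $h$). Let $J$ be the regular coverage on $(\mathrm{fp}\,K)^{op}$ whose covering families of an object $A$ are the singletons $\{h\}$ with $h\in\mathcal M$ of domain $A$ in $\mathrm{fp}\,K$, and let $\mathrm{Sh}((\mathrm{fp}\,K)^{op},J)$ be the topos of $\mathbf{Set}$-valued sheaves for $J$. An object $A$ of a topos is called supercompact if every jointly epimorphic family of morphisms $(B_i\to A)_{i\in I}$ contains an epimorphism; an object $C$ is called regular if it is supercompact and, for all morphisms $B\to C\leftarrow B'$ with $B$, $B'$ supercompact, the pullback $B\times_C B'$ is supercompact. Let $\mathrm{fun}_K(L)$ be the full subcategory of regular objects of $\mathrm{Sh}((\mathrm{fp}\,K)^{op},J)$, and let $L^+=(L,\mathbf{Set})^{\prod\to}$ be the category of all functors $L\to\mathbf{Set}$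 that preserve small products and directed colimits, with all natural transformations between them. Then there is an equivalence of categories $\mathrm{fun}_K(L)\simeq L^+$. Hence $\mathrm{fun}_K(L)$ does not depend on the embedding of $L$ into $K$: if $L'$ is a definable subcategory of a locally finitely presentable category $K'$ and $L\simeq L'$ as categories, then $\mathrm{fun}_K(L)\simeq\mathrm{fun}_{K'}(L')$. -/

import Mathlib

open CategoryTheory Limits Opposite

universe w v u u'

namespace DefinableCat

/-- A morphism `f : A ⟶ B` is (`ℵ₀`-)pure if, for every commutative square from a morphism
`g : A' ⟶ B'` between finitely presentable objects to `f`, the top morphism `A' ⟶ A`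
factors through `g`. -/
def IsPure {K : Type u} [Category.{w} K] {A B : K} (f : A ⟶ B) : Prop :=
  ∀ ⦃A' B' : K⦄, IsFinitelyPresentable.{w} A' → IsFinitelyPresentable.{w} B' →
    ∀ (g : A' ⟶ B') (a : A' ⟶ A) (b : B' ⟶ B), a ≫ f = g ≫ b → ∃ t : B' ⟶ A, g ≫ t = a

/-- A full subcategory of `K` (given by the property `L` of objects) is definable if it is closed
in `K` under (small) products, directed colimits and pure subobjects. -/
structure IsDefinable {K : Type u} [Category.{w} K] (L : ObjectProperty K) : Prop where
  products : ∀ I : Type w, L.IsClosedUnderLimitsOfShape (Discrete I)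
  directedColimits : ∀ (D : Type w) [PartialOrder D] [IsDirectedOrder D] [Nonempty D],
    L.IsClosedUnderColimitsOfShape D
  pureSubobjects : ∀ ⦃A B : K⦄ (f : A ⟶ B), Mono f → IsPure f → L B → L A

/-- The property of functors `A ⥤ Type w` of preserving small products and
small directed colimits. -/
def preservesProductsDirectedColimits (A : Type u) [Category.{v} A] :
    ObjectProperty (A ⥤ Type w) := fun F ↦
  (∀ I : Type w, PreservesLimitsOfShape (Discrete I) F) ∧
    ∀ (D : Type w) [PartialOrder D] [IsDirectedOrder D] [Nonempty D], PreservesColimitsOfShape D F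

/-- The category `A⁺` of functors from `A` to sets that preserve products and
directed colimits, and all natural transformations between them. -/
abbrev Plus (A : Type u) [Category.{v} A] :=
  (preservesProductsDirectedColimits.{w} A).FullSubcategory

/-- A family of morphisms with codomain `A` is jointly epimorphic. -/
def JointlyEpic {E : Type u} [Category.{v} E] {A : E} {I : Type w} {B : I → E}
    (f : ∀ i, B i ⟶ A) : Prop :=
  ∀ ⦃Z : E⦄ (g h : A ⟶ Z), (∀ i, f i ≫ g = f i ≫ h) → g = h

/-- An object is supercompact if every (small, possibly empty) jointly epimorphic family of
morphisms to it contains an epimorphism. -/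
def IsSupercompact {E : Type u} [Category.{v} E] (A : E) : Prop :=
  ∀ (I : Type w) (B : I → E) (f : ∀ i, B i ⟶ A), JointlyEpic f → ∃ i, Epi (f i)

/-- An object `C` is regular if it is supercompact and, for all supercompact `B`, `B'` over `C`,
every pullback of `B` and `B'` over `C` is supercompact. -/
def regularObjects (E : Type u) [Category.{v} E] : ObjectProperty E := fun C ↦
  IsSupercompact.{w} C ∧
    ∀ ⦃P B B' : E⦄ (p : P ⟶ B) (q : P ⟶ B') (b : B ⟶ C) (b' : B' ⟶ C),
      IsPullback p q b b' → IsSupercompact.{w} B → IsSupercompact.{w} B' → IsSupercompact.{w} P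

/-- The full subcategory `fp K` of finitely presentable objects. -/
abbrev Fp (K : Type u) [Category.{w} K] :=
  (ObjectProperty.isFinitelyPresentable.{w} K).FullSubcategory

/-- The morphisms of `fp K` with respect to which every object of `L` is injective. -/
def injMorphisms {K : Type u} [Category.{w} K] (L : ObjectProperty K) :
    MorphismProperty (Fp K) := fun A B h ↦
  ∀ ⦃X : K⦄, L X → ∀ a : A.obj ⟶ X, ∃ b : B.obj ⟶ X, h.hom ≫ b = a

section

variable {K : Type u} [Category.{w} K] [IsLocallyFinitelyPresentable.{w} K]

lemma exists_pushout_injMorphisms (L : ObjectProperty K) {A B A' : Fp K} (h : A ⟶ B)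
    (hh : injMorphisms L h) (g : A ⟶ A') :
    ∃ (B' : Fp K) (h' : A' ⟶ B') (g' : B ⟶ B'), injMorphisms L h' ∧ g ≫ h' = h ≫ g' := by
  have hA := A.property
  have hB := B.property
  have hA' := A'.property
  have hP : ObjectProperty.isFinitelyPresentable.{w} K (pushout g.hom h.hom) := by
    have := Cardinal.fact_isRegular_aleph0.{w}
    have (k : WalkingSpan) : IsCardinalPresentable.{w} ((span g.hom h.hom).obj k) .aleph0 := by
      rcases k with _ | _ | _
      exacts [hA, hA', hB]
    refine isCardinalPresentable_of_isColimit _ (colimit.isColimit (span g.hom h.hom))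
      (Cardinal.aleph0.{w}) ?_
    rw [hasCardinalLT_aleph0_iff]
    infer_instance
  refine ⟨⟨_, hP⟩, ObjectProperty.homMk (pushout.inl g.hom h.hom),
    ObjectProperty.homMk (pushout.inr g.hom h.hom), ?_, ?_⟩
  · intro X hX a
    obtain ⟨b, hb⟩ := hh hX (g.hom ≫ a)
    exact ⟨pushout.desc a b hb.symm, pushout.inl_desc _ _ _⟩
  · ext
    exact pushout.condition

/-- The regular coverage on `(fp K)ᵒᵖ` whose covering families are the singletons consisting of
(the opposites of) the morphisms of `fp K` with respect to which every object of `L` is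
injective. -/
def coverage (L : ObjectProperty K) : Coverage (Fp K)ᵒᵖ where
  coverings X := {R | ∃ (Y : (Fp K)ᵒᵖ) (f : Y ⟶ X),
    injMorphisms L f.unop ∧ R = Presieve.singleton f}
  pullback := by
    rintro X Z g _ ⟨Y, f, hf, rfl⟩
    obtain ⟨B', h', g', hh', e⟩ := exists_pushout_injMorphisms L f.unop hf g.unop
    refine ⟨Presieve.singleton h'.op, ⟨_, h'.op, hh', rfl⟩, ?_⟩
    rintro _ _ ⟨⟩
    exact ⟨_, g'.op, f, ⟨⟩, Quiver.Hom.unop_inj e.symm⟩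

/-- The sheaf topos `Sh((fp K)ᵒᵖ, J)`: set-valued sheaves on `(fp K)ᵒᵖ` for the Grothendieck
topology generated by `coverage L`. -/
abbrev FunTopos (L : ObjectProperty K) :=
  Sheaf (coverage L).toGrothendieck (Type w)

/-- The category `fun_K(L)` of regular objects of `Sh((fp K)ᵒᵖ, J)`. -/
abbrev FunCat (L : ObjectProperty K) :=
  (regularObjects.{w} (FunTopos L)).FullSubcategory

end

end DefinableCat

/-! The equivalence sends `F` in `L⁺` to the sheaf `A ↦ Nat(Hom(A, -), F)` (`natSheaf`). Its main
point is that `F` is locally representable by finitely presentable objects: every `t ∈ F(X)` is the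
image of some `a : A ⟶ X` under a transformation `Hom(A, -) ⟶ F` (`IsPlus.exists_cover`), and two
transformations agreeing at `a` agree after restriction along some `A ⟶ B` through which `a` factors
(`IsPlus.exists_eq_of_app_eq`). Thus `F(X)` is recovered from the sheaf, and full faithfulness
follows.

Both facts come from reduced products. Write `X` as a directed colimit of finitely presentable `A_d`
and choose arbitrary `A_d ⟶ Y_d` with `Y_d` in `L`. Then `X` maps to the reduced product of the
`Y_d` modulo tails, a directed colimit of products, so an element of `F(X)` yields elements of
`F(Y_d)` for large `d`, unique up to eventual equality (`IsGerm.eventually_eq`). Counterexamples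
chosen at every stage are thereby refuted all at once. If `Y_d` is a weak reflection of `A_d`, an
element of `F(Y_d)` that does not separate morphisms agreeing on `A_d` is a transformation `Hom(A_d,
-) ⟶ F`. Weak reflections come from the small object argument, because objects injective with
respect to `injMorphisms L` lie in `L` (`prop_of_injective`).

Preservation of products makes a single `Hom(A, -)` cover `F` (`IsPlus.exists_surjective`). Applied
also to fibre products over `F`, which are again in `L⁺`, this makes the sheaf of `F` regular.
Conversely, a regular sheaf has one generating section, whose equations are generated by one pair `A
⇉ B` (`exists_presentation`). On `L` this pair represents an equivalence relation on `Hom(A, -)`;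
the quotient is in `L⁺`, and its sheaf is the given one (`exists_natSheaf_iso`). Invariance holds
because `L⁺` refers only to the category `L`. -/

set_option linter.unusedSectionVars false

namespace DefinableCat

attribute [local instance] Cardinal.fact_isRegular_aleph0

/-! ### Locally finitely presentable categories: limits, directed presentations, purity -/

section LocallyFinitelyPresentable

variable (K : Type u) [Category.{w} K] [IsLocallyFinitelyPresentable.{w} K]

instance essentiallySmall_fp : EssentiallySmall.{w} (Fp K) :=
  have : ObjectProperty.EssentiallySmall.{w} (ObjectProperty.isFinitelyPresentable.{w} K) :=
    inferInstance
  inferInstance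

/-- A small skeleton of the finitely presentable objects, mapped into `K`. -/
noncomputable abbrev smallFp : SmallModel.{w} (Fp K) ⥤ K :=
  (equivSmallModel (Fp K)).inverse ⋙ (ObjectProperty.isFinitelyPresentable.{w} K).ι

/-- Density of the finitely presentable objects makes `K` reflective in presheaves on a small model
of them, and a reflective subcategory inherits limits. -/
theorem hasLimitsOfSize : HasLimitsOfSize.{w, w} K := by
  have : (ObjectProperty.isFinitelyPresentable.{w} K).ι.IsDense := inferInstance
  have : HasColimitsOfSize.{w, w} K := inferInstance
  let L := uliftYoneda.{w}.leftKanExtension (smallFp K)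
  let α : smallFp K ⟶ uliftYoneda.{w} ⋙ L := uliftYoneda.{w}.leftKanExtensionUnit (smallFp K)
  have : Reflective (Presheaf.restrictedULiftYoneda.{w} (smallFp K)) :=
    { L := L
      adj := Presheaf.uliftYonedaAdjunction L α }
  exact hasLimits_of_reflective (Presheaf.restrictedULiftYoneda.{w} (smallFp K))

instance hasProducts_of_isLocallyFinitelyPresentable (I : Type w) :
    HasLimitsOfShape (Discrete I) K :=
  have := hasLimitsOfSize K
  inferInstance

variable {K}

instance isClosedUnderColimits_fp (J : Type) [SmallCategory J] [FinCategory J] :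
    (ObjectProperty.isFinitelyPresentable.{w} K).IsClosedUnderColimitsOfShape J :=
  isClosedUnderColimitsOfShape_isCardinalPresentable K (κ := Cardinal.aleph0.{w})
    (by rw [hasCardinalLT_aleph0_iff]; infer_instance)

theorem exists_coprod_fp (A B : Fp K) : ∃ (C : Fp K) (i : A ⟶ C) (j : B ⟶ C),
    (∀ ⦃X : K⦄ (a : A.obj ⟶ X) (b : B.obj ⟶ X),
      ∃ c : C.obj ⟶ X, i.hom ≫ c = a ∧ j.hom ≫ c = b) ∧
    ∀ ⦃X : K⦄ (f g : C.obj ⟶ X), i.hom ≫ f = i.hom ≫ g → j.hom ≫ f = j.hom ≫ g → f = g := by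
  let C : Fp K := ⟨A.obj ⨿ B.obj,
    (ObjectProperty.isFinitelyPresentable.{w} K).prop_colimit _ (by
      rintro ⟨_ | _⟩
      exacts [A.property, B.property])⟩
  exact ⟨C, ObjectProperty.homMk coprod.inl, ObjectProperty.homMk coprod.inr,
    fun X a b ↦ ⟨coprod.desc a b, coprod.inl_desc _ _, coprod.inr_desc _ _⟩,
    fun X f g h₁ h₂ ↦ coprod.hom_ext h₁ h₂⟩

theorem exists_pushout_fp {A B C : Fp K} (f : A ⟶ B) (g : A ⟶ C) :
    ∃ (P : Fp K) (i : B ⟶ P) (j : C ⟶ P), f ≫ i = g ≫ j ∧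
      ∀ ⦃X : K⦄ (b : B.obj ⟶ X) (c : C.obj ⟶ X), f.hom ≫ b = g.hom ≫ c →
        ∃ p : P.obj ⟶ X, i.hom ≫ p = b ∧ j.hom ≫ p = c := by
  let P : Fp K := ⟨pushout f.hom g.hom,
    (ObjectProperty.isFinitelyPresentable.{w} K).prop_colimit _ (by
      rintro (_ | _ | _)
      exacts [A.property, B.property, C.property])⟩
  refine ⟨P, ObjectProperty.homMk (pushout.inl _ _), ObjectProperty.homMk (pushout.inr _ _), ?_,
    fun X b c h ↦ ⟨pushout.desc b c h, pushout.inl_desc _ _ _, pushout.inr_desc _ _ _⟩⟩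
  ext
  exact pushout.condition

theorem exists_coequalizer_fp {A B : Fp K} (f g : A ⟶ B) :
    ∃ (C : Fp K) (q : B ⟶ C), f ≫ q = g ≫ q ∧
      ∀ ⦃X : K⦄ (b : B.obj ⟶ X), f.hom ≫ b = g.hom ≫ b → ∃ c : C.obj ⟶ X, q.hom ≫ c = b := by
  let C : Fp K := ⟨coequalizer f.hom g.hom,
    (ObjectProperty.isFinitelyPresentable.{w} K).prop_colimit _ (by
      rintro (_ | _)
      exacts [A.property, B.property])⟩
  refine ⟨C, ObjectProperty.homMk (coequalizer.π _ _), ?_,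
    fun X b h ↦ ⟨coequalizer.desc b h, coequalizer.π_desc _ _⟩⟩
  ext
  exact coequalizer.condition _ _

/-- A presentation of an object as a colimit of finitely presentable objects indexed by a
directed partially ordered set. -/
structure DirectedPresentation (X : K) where
  /-- the directed index set -/
  D : Type w
  [partialOrder : PartialOrder D]
  [isDirected : IsDirectedOrder D]
  [nonempty : Nonempty D]
  /-- the diagram of finitely presentable objects -/
  diag : D ⥤ Fp K
  /-- the cocone -/
  ι : diag ⋙ (ObjectProperty.isFinitelyPresentable.{w} K).ι ⟶ (Functor.const D).obj X
  /-- the cocone is colimiting -/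
  isColimit : IsColimit (Cocone.mk X ι)

attribute [instance] DirectedPresentation.partialOrder DirectedPresentation.isDirected
  DirectedPresentation.nonempty

theorem exists_directedPresentation (X : K) : Nonempty (DirectedPresentation X) := by
  obtain ⟨J, _, _, ⟨p⟩⟩ :=
    (isCardinalFilteredGenerator_isCardinalPresentable K
      Cardinal.aleph0.{w}).exists_colimitsOfShape X
  have := isFiltered_of_isCardinalFiltered J Cardinal.aleph0.{w}
  obtain ⟨D, _, _, _, G, _⟩ := IsFiltered.exists_directed J
  exact ⟨{ D := D
           isDirected := ‹_›
           diag := ObjectProperty.lift _ (G ⋙ p.diag) fun d ↦ p.prop_diag_obj _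
           ι := Functor.whiskerLeft G p.ι
           isColimit := (Functor.Final.isColimitWhiskerEquiv G _).symm p.isColimit }⟩

namespace DirectedPresentation

variable {X : K} (p : DirectedPresentation X)

/-- The structure morphisms of a directed presentation. -/
def incl (d : p.D) : (p.diag.obj d).obj ⟶ X := p.ι.app d

theorem w {d e : p.D} (f : d ⟶ e) : (p.diag.map f).hom ≫ p.incl e = p.incl d := by
  exact (p.ι.naturality f).trans (Category.comp_id _)

theorem exists_lift (B : Fp K) (b : B.obj ⟶ X) :
    ∃ d, ∃ f : B ⟶ p.diag.obj d, f.hom ≫ p.incl d = b := by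
  have : IsFinitelyPresentable.{w} B.obj := B.property
  obtain ⟨d, f, hf⟩ := IsFinitelyPresentable.exists_hom_of_isColimit p.isColimit b
  exact ⟨d, ObjectProperty.homMk f, hf⟩

theorem hom_ext {Y : K} {f g : X ⟶ Y} (h : ∀ d, p.incl d ≫ f = p.incl d ≫ g) : f = g :=
  p.isColimit.hom_ext h

theorem exists_desc {Y : K} (f : ∀ d, (p.diag.obj d).obj ⟶ Y)
    (hf : ∀ {d e : p.D} (k : d ⟶ e), (p.diag.map k).hom ≫ f e = f d) :
    ∃ g : X ⟶ Y, ∀ d, p.incl d ≫ g = f d :=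
  ⟨p.isColimit.desc (Cocone.mk Y { app := f, naturality := fun _ _ k ↦ by simpa using hf k }),
    fun d ↦ p.isColimit.fac _ d⟩

end DirectedPresentation

theorem hom_ext_fp {X Y : K} {f g : X ⟶ Y} (h : ∀ (A : Fp K) (a : A.obj ⟶ X), a ≫ f = a ≫ g) :
    f = g := by
  obtain ⟨p⟩ := exists_directedPresentation X
  exact p.hom_ext fun d ↦ h _ _

/-- Purity is tested on the codiagonal `A ⨿ A ⟶ A`: a map from `A ⨿ A` that factors through it has
equal components. -/
theorem IsPure.mono {X Y : K} {f : X ⟶ Y} (hf : IsPure f) : Mono f where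
  right_cancellation {Z} u v huv := by
    refine hom_ext_fp fun A a ↦ ?_
    obtain ⟨C, i, j, hC, hC'⟩ := exists_coprod_fp A A
    obtain ⟨g, hg₁, hg₂⟩ := hC (𝟙 A.obj) (𝟙 A.obj)
    obtain ⟨c, hc₁, hc₂⟩ := hC (a ≫ u) (a ≫ v)
    obtain ⟨t, ht⟩ := hf C.property A.property g c (a ≫ u ≫ f) (hC' _ _
      (by rw [reassoc_of% hc₁, reassoc_of% hg₁]) (by rw [reassoc_of% hc₂, reassoc_of% hg₂, huv]))
    rw [← hc₁, ← hc₂, ← ht, reassoc_of% hg₁, reassoc_of% hg₂]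

end LocallyFinitelyPresentable

end DefinableCat

namespace DefinableCat

attribute [local instance] Cardinal.fact_isRegular_aleph0

/-! ### Preservation of products and directed colimits in terms of elements -/

section Elementwise

variable {A : Type u} [Category.{v} A]

/-- The elementwise form of preserving products and directed colimits. -/
structure IsPlus (F : A ⥤ Type w) : Prop where
  existsUnique : ∀ {I : Type w} {Y : Discrete I ⥤ A} {c : Cone Y} (_ : IsLimit c)
    (s : ∀ i, F.obj (Y.obj ⟨i⟩)), ∃! x : F.obj c.pt, ∀ i, F.map (c.π.app ⟨i⟩) x = s i
  exists_rep : ∀ {D : Type w} [PartialOrder D] [IsDirectedOrder D] [Nonempty D] {Y : D ⥤ A}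
    {c : Cocone Y} (_ : IsColimit c) (x : F.obj c.pt), ∃ d y, F.map (c.ι.app d) y = x
  exists_eq : ∀ {D : Type w} [PartialOrder D] [IsDirectedOrder D] [Nonempty D] {Y : D ⥤ A}
    {c : Cocone Y} (_ : IsColimit c) (d : D) (x y : F.obj (Y.obj d)),
      F.map (c.ι.app d) x = F.map (c.ι.app d) y →
        ∃ (e : D) (k : d ⟶ e), F.map (Y.map k) x = F.map (Y.map k) y

theorem isPlus_iff (F : A ⥤ Type w) :
    preservesProductsDirectedColimits.{w} A F ↔ IsPlus F := by
  constructor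
  · rintro ⟨h₁, h₂⟩
    refine ⟨fun {I Y c} hc s ↦ ?_, fun {D} _ _ _ {Y c} hc x ↦ ?_, fun {D} _ _ _ {Y c} hc d x y h ↦ ?_⟩
    · have := h₁ I
      obtain ⟨x, hx, hx'⟩ := (Types.isLimit_iff _).1 ⟨isLimitOfPreserves F hc⟩ (fun i ↦ s i.as) (by
        rintro ⟨i⟩ ⟨j⟩ ⟨⟨⟨⟩⟩⟩
        exact congr($((Y ⋙ F).map_id _) (s i)))
      exact ⟨x, fun i ↦ hx ⟨i⟩, fun y hy ↦ hx' _ fun i ↦ hy i.as⟩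
    · have := h₂ D
      exact Types.jointly_surjective_of_isColimit (isColimitOfPreserves F hc) x
    · have := h₂ D
      exact (Types.FilteredColimit.isColimit_eq_iff' (isColimitOfPreserves F hc) x y).1 h
  · intro h
    refine ⟨fun I ↦ ⟨fun {Y} ↦ ⟨fun {c} hc ↦ ?_⟩⟩, fun D _ _ _ ↦ ⟨fun {Y} ↦ ⟨fun {c} hc ↦ ?_⟩⟩⟩
    · rw [Types.isLimit_iff]
      intro s _
      obtain ⟨x, hx, hx'⟩ := h.existsUnique hc fun i ↦ s ⟨i⟩
      exact ⟨x, fun i ↦ hx i.as, fun y hy ↦ hx' _ fun i ↦ hy ⟨i⟩⟩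
    · exact ⟨Types.FilteredColimit.isColimitOf' _ _ (fun x ↦ by
        obtain ⟨d, y, hy⟩ := h.exists_rep hc x
        exact ⟨d, y, hy.symm⟩) fun d x y hxy ↦ h.exists_eq hc d x y hxy⟩

end Elementwise

/-! ### Reduced products modulo the filter of tails -/

section ReducedProduct

variable {A : Type u} [Category.{v} A] [∀ I : Type w, HasLimitsOfShape (Discrete I) A]
  {D : Type w} [PartialOrder D] [IsDirectedOrder D] [Nonempty D]

/-- The products of the tails of a family of objects indexed by a directed set. -/
noncomputable def tailProducts (Y : D → A) : D ⥤ A where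
  obj d := ∏ᶜ fun e : Set.Ici d ↦ Y e
  map {d e} k := Pi.lift fun f : Set.Ici e ↦
    Pi.π (fun f : Set.Ici d ↦ Y f) ⟨f.1, k.le.trans f.2⟩
  map_id d := Pi.hom_ext _ _ fun e ↦ by simp
  map_comp k l := Pi.hom_ext _ _ fun e ↦ by simp

/-- The projections of a product over a tail. -/
noncomputable def tailProducts.π (Y : D → A) {d e : D} (h : d ≤ e) : (tailProducts Y).obj d ⟶ Y e :=
  Pi.π (fun e : Set.Ici d ↦ Y e) ⟨e, h⟩

theorem tailProducts.map_π (Y : D → A) {d e f : D} (k : d ⟶ e) (h : e ≤ f) :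
    (tailProducts Y).map k ≫ π Y h = π Y (k.le.trans h) :=
  Pi.lift_π (f := fun f : Set.Ici e ↦ Y f) _ _

theorem tailProducts.hom_ext {Y : D → A} {d : D} {Z : A} {f g : Z ⟶ (tailProducts Y).obj d}
    (h : ∀ (e : D) (hde : d ≤ e), f ≫ π Y hde = g ≫ π Y hde) : f = g :=
  Pi.hom_ext (f := fun f : Set.Ici d ↦ Y f) _ _ fun e ↦ h e.1 e.2

theorem tailProducts.exists_lift {Y : D → A} {d : D} {Z : A} (f : ∀ e, d ≤ e → (Z ⟶ Y e)) :
    ∃ g : Z ⟶ (tailProducts Y).obj d, ∀ (e : D) (h : d ≤ e), g ≫ π Y h = f e h :=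
  ⟨Pi.lift fun e : Set.Ici d ↦ f e.1 e.2, fun e h ↦
    Pi.lift_π (f := fun f : Set.Ici d ↦ Y f) _ ⟨e, h⟩⟩

/-- The map on tail products induced by a family of morphisms. -/
noncomputable def tailProducts.map {Y Z : D → A} (f : ∀ d, Y d ⟶ Z d) :
    tailProducts Y ⟶ tailProducts Z where
  app d := (exists_lift fun e h ↦ π Y h ≫ f e).choose
  naturality d e k := hom_ext fun e' h ↦ by
    rw [Category.assoc, Category.assoc, map_π,
      (exists_lift fun e h ↦ π Y h ≫ f e).choose_spec,
      (exists_lift fun e h ↦ π Y h ≫ f e).choose_spec, ← Category.assoc, map_π]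

theorem tailProducts.map_app_π {Y Z : D → A} (f : ∀ d, Y d ⟶ Z d) {d e : D} (h : d ≤ e) :
    (map f).app d ≫ π Z h = π Y h ≫ f e :=
  (exists_lift fun e h ↦ π Y h ≫ f e).choose_spec _ _

variable [HasColimitsOfShape D A]

/-- The reduced product of a family of objects indexed by a directed set, modulo the filter of
tails. -/
noncomputable def reducedProduct (Y : D → A) : A := colimit (tailProducts Y)

/-- The structure morphisms of a reduced product. -/
noncomputable def reducedProduct.ι (Y : D → A) (d : D) :
    (tailProducts Y).obj d ⟶ reducedProduct Y :=
  colimit.ι (tailProducts Y) d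

theorem reducedProduct.w (Y : D → A) {d e : D} (k : d ⟶ e) :
    (tailProducts Y).map k ≫ ι Y e = ι Y d :=
  colimit.w _ _

/-- The map on reduced products induced by a family of morphisms. -/
noncomputable def reducedProduct.map {Y Z : D → A} (f : ∀ d, Y d ⟶ Z d) :
    reducedProduct Y ⟶ reducedProduct Z :=
  colimMap (tailProducts.map f)

theorem reducedProduct.ι_map {Y Z : D → A} (f : ∀ d, Y d ⟶ Z d) (d : D) :
    ι Y d ≫ map f = (tailProducts.map f).app d ≫ ι Z d :=
  ι_colimMap _ _

theorem IsPlus.exists_rep_reducedProduct {F : A ⥤ Type w} (hF : IsPlus F) {Y : D → A}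
    (x : F.obj (reducedProduct Y)) : ∃ d y, F.map (reducedProduct.ι Y d) y = x :=
  hF.exists_rep (colimit.isColimit (tailProducts Y)) x

theorem IsPlus.exists_eq_reducedProduct {F : A ⥤ Type w} (hF : IsPlus F) {Y : D → A} {d e : D}
    {x : F.obj ((tailProducts Y).obj d)} {y : F.obj ((tailProducts Y).obj e)}
    (h : F.map (reducedProduct.ι Y d) x = F.map (reducedProduct.ι Y e) y) :
    ∃ c, d ≤ c ∧ e ≤ c ∧ ∀ (i : D) (h₁ : d ≤ i) (h₂ : e ≤ i), c ≤ i →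
      F.map (tailProducts.π Y h₁) x = F.map (tailProducts.π Y h₂) y := by
  obtain ⟨b, hb₁, hb₂⟩ := exists_ge_ge d e
  obtain ⟨c, k, hc⟩ := hF.exists_eq (colimit.isColimit (tailProducts Y)) b
    (F.map ((tailProducts Y).map (homOfLE hb₁)) x) (F.map ((tailProducts Y).map (homOfLE hb₂)) y)
    (by
      rw [← Functor.map_comp_apply, ← Functor.map_comp_apply]
      exact (congr(F.map $(reducedProduct.w Y (homOfLE hb₁)) x).trans h).trans
        congr(F.map $(reducedProduct.w Y (homOfLE hb₂)) y).symm)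
  refine ⟨c, hb₁.trans k.le, hb₂.trans k.le, fun i h₁ h₂ hi ↦ ?_⟩
  have := congr(F.map (tailProducts.π Y hi) $hc)
  simpa only [← Functor.map_comp_apply, tailProducts.map_π, Category.assoc] using this

end ReducedProduct

end DefinableCat

namespace DefinableCat

attribute [local instance] Cardinal.fact_isRegular_aleph0 Cardinal.orderBotAleph0OrdToType

/-! ### Injectivity characterizes definable subcategories; weak reflections -/

section Definable

variable {K : Type u} [Category.{w} K] [IsLocallyFinitelyPresentable.{w} K]
  (L : ObjectProperty K)

/-- The functor `Hom(B, -)` on a full subcategory, for an object `B` of the ambient category. -/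
abbrev homFunctor (B : K) : L.FullSubcategory ⥤ Type w := L.ι ⋙ coyoneda.obj (op B)

variable {L} [hL : Fact (IsDefinable L)]

instance closedUnderProducts (I : Type w) : L.IsClosedUnderLimitsOfShape (Discrete I) :=
  hL.out.products I

instance closedUnderDirectedColimits (D : Type w) [PartialOrder D] [IsDirectedOrder D]
    [Nonempty D] : L.IsClosedUnderColimitsOfShape D :=
  hL.out.directedColimits D

theorem homFunctor_existsUnique (B : K) {I : Type w} {Y : Discrete I ⥤ L.FullSubcategory}
    {c : Cone Y} (hc : IsLimit c) (s : ∀ i, B ⟶ (Y.obj ⟨i⟩).obj) :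
    ∃! x : B ⟶ c.pt.obj, ∀ i, x ≫ (c.π.app ⟨i⟩).hom = s i := by
  let hc' := isLimitOfPreserves L.ι hc
  let t : Cone (Y ⋙ L.ι) := ⟨B, Discrete.natTrans fun i ↦ s i.as⟩
  exact ⟨hc'.lift t, fun i ↦ hc'.fac t ⟨i⟩, fun y hy ↦ hc'.uniq t y fun i ↦ hy i.as⟩

theorem isPlus_homFunctor (B : Fp K) : IsPlus (homFunctor L B.obj) where
  existsUnique hc s := homFunctor_existsUnique B.obj hc s
  exists_rep {D} _ _ _ {Y c} hc x := by
    have : IsFinitelyPresentable.{w} B.obj := B.property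
    exact IsFinitelyPresentable.exists_hom_of_isColimit (isColimitOfPreserves L.ι hc) x
  exists_eq {D} _ _ _ {Y c} hc d x y h := by
    have : IsFinitelyPresentable.{w} B.obj := B.property
    obtain ⟨e, k, l, h⟩ :=
      IsFinitelyPresentable.exists_eq_of_isColimit (isColimitOfPreserves L.ι hc) x y h
    obtain rfl := Subsingleton.elim k l
    exact ⟨e, k, h⟩

section

variable {D : Type w} [PartialOrder D] [IsDirectedOrder D] [Nonempty D]
  {Y : D → L.FullSubcategory} {B : K} {d : D}

theorem exists_hom_tailProducts (f : ∀ e, d ≤ e → (B ⟶ (Y e).obj)) :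
    ∃ g : B ⟶ ((tailProducts Y).obj d).obj,
      ∀ (e : D) (h : d ≤ e), g ≫ (tailProducts.π Y h).hom = f e h := by
  obtain ⟨x, hx, -⟩ := homFunctor_existsUnique B
    (productIsProduct fun e : Set.Ici d ↦ Y e) fun e ↦ f e.1 e.2
  exact ⟨x, fun e h ↦ hx ⟨e, h⟩⟩

theorem hom_tailProducts_ext {f g : B ⟶ ((tailProducts Y).obj d).obj}
    (h : ∀ (e : D) (hde : d ≤ e),
      f ≫ (tailProducts.π Y hde).hom = g ≫ (tailProducts.π Y hde).hom) : f = g :=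
  (homFunctor_existsUnique B (productIsProduct fun e : Set.Ici d ↦ Y e)
    fun e ↦ g ≫ (tailProducts.π Y e.2).hom).unique (y₁ := f) (y₂ := g)
      (fun e ↦ h e.1 e.2) fun _ ↦ rfl

end

namespace DirectedPresentation

variable {X : K} (p : DirectedPresentation X) {Y : p.D → L.FullSubcategory}

/-- On the stage `d` the map is the tuple of composites to `Y e` for `e ≥ d`. Enlarging `d` only
shortens the tuple, so the stages are compatible although the `y d` need not be. -/
theorem exists_toReducedProduct (y : ∀ d, (p.diag.obj d).obj ⟶ (Y d).obj) :
    ∃ f : X ⟶ (reducedProduct Y).obj, ∀ (d : p.D)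
      (l : (p.diag.obj d).obj ⟶ ((tailProducts Y).obj d).obj),
      (∀ (e : p.D) (h : d ≤ e), l ≫ (tailProducts.π Y h).hom =
        (p.diag.map (homOfLE h)).hom ≫ y e) →
      p.incl d ≫ f = l ≫ (reducedProduct.ι Y d).hom := by
  choose l hl using fun d ↦ exists_hom_tailProducts (L := L) (Y := Y) (d := d)
    fun e h ↦ (p.diag.map (homOfLE h)).hom ≫ y e
  obtain ⟨f, hf⟩ := p.exists_desc (fun d ↦ l d ≫ (reducedProduct.ι Y d).hom) fun {d e} k ↦ by
    rw [← reducedProduct.w Y k, ObjectProperty.FullSubcategory.comp_hom, ← Category.assoc,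
      ← Category.assoc]
    congr 1
    refine hom_tailProducts_ext fun i hi ↦ ?_
    rw [Category.assoc, hl, Category.assoc, ← ObjectProperty.FullSubcategory.comp_hom,
      tailProducts.map_π, hl, ← Category.assoc, ← ObjectProperty.FullSubcategory.comp_hom,
      ← p.diag.map_comp]
    rfl
  refine ⟨f, fun d l' hl' ↦ ?_⟩
  rw [hf, show l d = l' from hom_tailProducts_ext fun e h ↦ (hl d e h).trans (hl' e h).symm]

/-- The morphism to a reduced product induced by a family of morphisms on the objects of a
directed presentation. -/
noncomputable def toReducedProduct (y : ∀ d, (p.diag.obj d).obj ⟶ (Y d).obj) :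
    X ⟶ (reducedProduct Y).obj :=
  (p.exists_toReducedProduct y).choose

theorem incl_toReducedProduct (y : ∀ d, (p.diag.obj d).obj ⟶ (Y d).obj) (d : p.D)
    (l : (p.diag.obj d).obj ⟶ ((tailProducts Y).obj d).obj)
    (hl : ∀ (e : p.D) (h : d ≤ e), l ≫ (tailProducts.π Y h).hom =
        (p.diag.map (homOfLE h)).hom ≫ y e) :
    p.incl d ≫ p.toReducedProduct y = l ≫ (reducedProduct.ι Y d).hom :=
  (p.exists_toReducedProduct y).choose_spec d l hl

end DirectedPresentation

/-- Every object that is injective with respect to `injMorphisms L` is in `L`. -/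
theorem prop_of_injective (X : K)
    (hX : ∀ ⦃A B : Fp K⦄ (h : A ⟶ B), injMorphisms L h → ∀ a : A.obj ⟶ X,
      ∃ b : B.obj ⟶ X, h.hom ≫ b = a) : L X := by
  obtain ⟨p⟩ := exists_directedPresentation X
  -- If `p.incl d` does not factor through `h`, then `h` is not in `injMorphisms L`, so some map to
  -- an object of `L` does not factor through `h` either. `Y` is the product of such objects over a
  -- small set of representatives of all these `h`.
  have key (d : p.D) : ∃ (Y : L.FullSubcategory) (y : (p.diag.obj d).obj ⟶ Y.obj),
      ∀ (B : Fp K) (h : p.diag.obj d ⟶ B), (∃ b : B.obj ⟶ Y.obj, h.hom ≫ b = y) →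
        ∃ b : B.obj ⟶ X, h.hom ≫ b = p.incl d := by
    let I : Type w := {q : Σ B : SmallModel.{w} (Fp K),
      p.diag.obj d ⟶ (equivSmallModel (Fp K)).inverse.obj B //
        ¬ ∃ b : ((equivSmallModel (Fp K)).inverse.obj q.1).obj ⟶ X, q.2.hom ≫ b = p.incl d}
    have hI (i : I) : ∃ (Y : L.FullSubcategory) (y : (p.diag.obj d).obj ⟶ Y.obj),
        ¬ ∃ b, i.1.2.hom ≫ b = y := by
      by_contra! H
      exact i.2 (hX i.1.2 (fun Z hZ a ↦ H ⟨Z, hZ⟩ a) (p.incl d))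
    choose Y y hy using hI
    obtain ⟨z, hz, -⟩ := homFunctor_existsUnique (p.diag.obj d).obj (productIsProduct Y) y
    refine ⟨∏ᶜ Y, z, fun B h ⟨b, hb⟩ ↦ ?_⟩
    by_contra H
    let e := (equivSmallModel (Fp K)).unitIso.app B
    let i : I := ⟨⟨(equivSmallModel (Fp K)).functor.obj B, h ≫ e.hom⟩, by
      rintro ⟨c, hc⟩
      exact H ⟨e.hom.hom ≫ c, by simpa using hc⟩⟩
    refine hy i ⟨e.inv.hom ≫ b ≫ (Pi.π Y i).hom, ?_⟩
    refine Eq.trans ?_ (hz i)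
    rw [← hb]
    have hh : h ≫ e.hom ≫ e.inv = h := by simp
    replace hh : h.hom ≫ e.hom.hom ≫ e.inv.hom = h.hom := congr(($hh).hom)
    change (h.hom ≫ e.hom.hom) ≫ e.inv.hom ≫ b ≫ (Pi.π Y i).hom = (h.hom ≫ b) ≫ (Pi.π Y i).hom
    simpa only [Category.assoc] using congr($hh ≫ b ≫ (Pi.π Y i).hom)
  choose Y y hy using key
  have hpure : IsPure (p.toReducedProduct y) := by
    intro A B hA hB g a b hab
    obtain ⟨d₁, a₁, rfl⟩ := p.exists_lift ⟨A, hA⟩ a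
    obtain ⟨d₂, b₂, rfl⟩ := (isPlus_homFunctor ⟨B, hB⟩).exists_rep_reducedProduct b
    obtain ⟨l, hl⟩ := exists_hom_tailProducts (L := L) (Y := Y) (d := d₁)
      fun e h ↦ (p.diag.map (homOfLE h)).hom ≫ y e
    rw [Category.assoc, p.incl_toReducedProduct y d₁ l hl] at hab
    obtain ⟨c, hc₁, hc₂, hc⟩ := (isPlus_homFunctor (L := L) ⟨A, hA⟩).exists_eq_reducedProduct
      (x := a₁.hom ≫ l) (y := g ≫ b₂) (d := d₁) (e := d₂)
      (by simpa using hab)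
    have hc := hc c hc₁ hc₂ le_rfl
    replace hc : a₁.hom ≫ (p.diag.map (homOfLE hc₁)).hom ≫ y c =
        g ≫ b₂ ≫ (tailProducts.π Y hc₂).hom := by
      rw [← hl]
      simpa using hc
    -- The square already lives at the stage `c`, so `y c` factors through the pushout of `g`. By
    -- the choice of `y c` the same holds for `p.incl c`, which gives the required map from `B` to
    -- `X`.
    obtain ⟨P, i, j, hij, hP⟩ := exists_pushout_fp (A := ⟨A, hA⟩) (B := p.diag.obj c) (C := ⟨B, hB⟩)
      (a₁ ≫ p.diag.map (homOfLE hc₁)) (ObjectProperty.homMk g)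
    obtain ⟨q, hq, -⟩ := hP (y c) (b₂ ≫ (tailProducts.π Y hc₂).hom) (by simpa using hc)
    obtain ⟨r, hr⟩ := hy c P i ⟨q, hq⟩
    refine ⟨j.hom ≫ r, ?_⟩
    have := congr(($hij).hom ≫ r)
    simp only [ObjectProperty.FullSubcategory.comp_hom, Category.assoc, hr, p.w] at this
    exact this.symm
  exact hL.out.pureSubobjects _ hpure.mono hpure (reducedProduct Y).property

/-- Every finitely presentable object has a weak reflection in `L`. -/
theorem exists_weaklyInitial (A : Fp K) :
    ∃ (W : L.FullSubcategory) (c : A.obj ⟶ W.obj), ∀ (X : L.FullSubcategory) (a : A.obj ⟶ X.obj),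
      ∃ f : W ⟶ X, c ≫ f.hom = a := by
  let S := SmallModel.{w} (Fp K)
  let E := (equivSmallModel.{w} (Fp K)).inverse
  let T : Type w := Σ (A B : S), {h : A ⟶ B // injMorphisms L (E.map h)}
  let I : MorphismProperty K := MorphismProperty.ofHoms fun t : T ↦ (E.map t.2.2.1).hom
  have : MorphismProperty.IsSmall.{w} I := MorphismProperty.isSmall_ofHoms ..
  -- Countable iteration suffices because the domains in `I` are finitely presentable.
  have : MorphismProperty.IsCardinalForSmallObjectArgument I Cardinal.aleph0.{w} :=
    { hasIterationOfShape := by infer_instance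
      preservesColimit := by
        intro A B X Y i hi f hf
        have : IsFinitelyPresentable.{w} A := by
          obtain ⟨t⟩ := hi
          exact (E.obj t.1).property
        infer_instance }
  have : MorphismProperty.HasSmallObjectArgument.{w} I :=
    ⟨.aleph0, inferInstance, inferInstance, inferInstance⟩
  have := hasLimitsOfSize K
  have : HasLimitsOfSize.{0, 0} K := hasLimitsOfSizeShrink.{0, 0, w, w} K
  let F := MorphismProperty.factorizationData I.rlp.llp I.rlp (terminal.from A.obj)
  have hW : L F.Z := by
    refine prop_of_injective _ fun B C h hh b ↦ ?_
    let e (B : Fp K) := (equivSmallModel (Fp K)).unitIso.app B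
    let h' := (equivSmallModel (Fp K)).functor.map h
    have h₁ : h.hom ≫ (e C).hom.hom = (e B).hom.hom ≫ (E.map h').hom :=
      congr(($((equivSmallModel (Fp K)).unitIso.hom.naturality h)).hom)
    have h₂ (B : Fp K) : (e B).hom.hom ≫ (e B).inv.hom = 𝟙 _ := congr(($((e B).hom_inv_id)).hom)
    have h₃ (B : Fp K) : (e B).inv.hom ≫ (e B).hom.hom = 𝟙 _ := congr(($((e B).inv_hom_id)).hom)
    have hE' : injMorphisms L (E.map h') := by
      intro X hX a
      obtain ⟨c, hc⟩ := hh hX ((e B).hom.hom ≫ a)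
      refine ⟨(e C).inv.hom ≫ c, ?_⟩
      calc _ = ((e B).inv.hom ≫ (e B).hom.hom) ≫ (E.map h').hom ≫ (e C).inv.hom ≫ c := by
            rw [h₃]; exact (Category.id_comp _).symm
        _ = (e B).inv.hom ≫ h.hom ≫ ((e C).hom.hom ≫ (e C).inv.hom) ≫ c := by
            simp only [Category.assoc, ← reassoc_of% h₁]
        _ = (e B).inv.hom ≫ (e B).hom.hom ≫ a := by
            rw [h₂, ← hc]; congr 2; exact Category.id_comp _
        _ = a := by rw [← Category.assoc, h₃]; exact Category.id_comp _
    have hI : I (E.map h').hom := MorphismProperty.ofHoms_iff .. |>.2 ⟨⟨_, _, h', hE'⟩, rfl⟩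
    have := F.hp _ hI
    have sq : CommSq ((e B).inv.hom ≫ b) (E.map h').hom F.p (terminal.from _) :=
      ⟨Subsingleton.elim _ _⟩
    refine ⟨(e C).hom.hom ≫ sq.lift, ?_⟩
    rw [← Category.assoc, h₁, Category.assoc, sq.fac_left, ← Category.assoc, h₂]
    exact Category.id_comp _
  refine ⟨⟨F.Z, hW⟩, F.i, fun X a ↦ ?_⟩
  have hX := X.property
  -- Objects of `L` are injective with respect to `I`, so their maps to the terminal object lift
  -- against the left factor.
  have := F.hi (terminal.from X.obj) (by
    rintro _ _ _ ⟨t⟩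
    refine ⟨fun {f _} sq ↦ ⟨?_⟩⟩
    obtain ⟨b, hb⟩ := t.2.2.2 hX f
    exact ⟨⟨b, hb, Subsingleton.elim _ _⟩⟩)
  have sq : CommSq a F.i (terminal.from X.obj) (terminal.from F.Z) := ⟨Subsingleton.elim _ _⟩
  exact ⟨ObjectProperty.homMk sq.lift, sq.fac_left⟩

end Definable

end DefinableCat

namespace DefinableCat

/-! ### Local representability of functors in `L⁺` -/

section Covers

variable {K : Type u} [Category.{w} K] [IsLocallyFinitelyPresentable.{w} K]
  {L : ObjectProperty K}

variable (L) in
/-- The contravariant dependence of `homFunctor L A` on the finitely presentable object `A`. -/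
abbrev homFunctorMap {A B : Fp K} (h : A ⟶ B) : homFunctor L B.obj ⟶ homFunctor L A.obj :=
  L.ι.whiskerLeft (coyoneda.map h.hom.op)

theorem homFunctorMap_id (A : Fp K) : homFunctorMap L (𝟙 A) = 𝟙 _ := by
  ext X a
  exact Category.id_comp a

theorem homFunctorMap_comp {A B C : Fp K} (f : A ⟶ B) (g : B ⟶ C) :
    homFunctorMap L (f ≫ g) = homFunctorMap L g ≫ homFunctorMap L f := by
  ext X a
  exact Category.assoc f.hom g.hom a

variable {F : L.FullSubcategory ⥤ Type w}

theorem map_app_homFunctor {A : K} (τ : homFunctor L A ⟶ F) {X Y : L.FullSubcategory} (f : X ⟶ Y)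
    (a : A ⟶ X.obj) : F.map f (τ.app X a) = τ.app Y (a ≫ f.hom) :=
  (NatTrans.naturality_apply τ f a).symm

theorem homFunctor_hom_ext {A : K} {σ τ : homFunctor L A ⟶ F}
    (h : ∀ (X : L.FullSubcategory) (a : A ⟶ X.obj), σ.app X a = τ.app X a) : σ = τ := by
  ext X a
  exact h X a

/-- A weak Yoneda lemma: every `A ⟶ X` extends along `c`, and `hs` makes the value independent of
the extension. -/
theorem exists_natTrans_of_weaklyInitial {A : K} {W : L.FullSubcategory} {c : A ⟶ W.obj}
    (hc : ∀ (X : L.FullSubcategory) (a : A ⟶ X.obj), ∃ f : W ⟶ X, c ≫ f.hom = a) {s : F.obj W}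
    (hs : ∀ (X : L.FullSubcategory) (f g : W ⟶ X), c ≫ f.hom = c ≫ g.hom → F.map f s = F.map g s) :
    ∃ τ : homFunctor L A ⟶ F, ∀ (X : L.FullSubcategory) (f : W ⟶ X),
      τ.app X (c ≫ f.hom) = F.map f s := by
  choose f hf using hc
  refine ⟨{ app := fun X ↦ TypeCat.ofHom fun a ↦ F.map (f X a) s
            naturality := fun X Y g ↦ ?_ }, fun X g ↦ hs _ _ _ (hf _ _)⟩
  ext a
  change F.map (f Y (a ≫ g.hom)) s = F.map g (F.map (f X a) s)
  rw [← Functor.map_comp_apply]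
  refine hs _ _ _ ?_
  rw [hf, ObjectProperty.FullSubcategory.comp_hom, ← Category.assoc, hf]

variable [hL : Fact (IsDefinable L)]

namespace DirectedPresentation

variable {X : L.FullSubcategory} (p : DirectedPresentation X.obj)

/-- A compatible family of values of `F` on a family of objects under the objects of a directed
presentation, which represents the image of `t` in the value of `F` at the reduced product. -/
def IsGerm (t : F.obj X) {Y : p.D → L.FullSubcategory} (y : ∀ d, (p.diag.obj d).obj ⟶ (Y d).obj)
    (d : p.D) (s : ∀ e, d ≤ e → F.obj (Y e)) : Prop :=
  ∃ x : F.obj ((tailProducts Y).obj d), (∀ (e : p.D) (h : d ≤ e),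
    F.map (tailProducts.π Y h) x = s e h) ∧
    F.map (reducedProduct.ι Y d) x =
      F.map (ObjectProperty.homMk (p.toReducedProduct y) : X ⟶ reducedProduct Y) t

variable {p}

theorem exists_isGerm (hF : IsPlus F) (t : F.obj X) {Y : p.D → L.FullSubcategory}
    (y : ∀ d, (p.diag.obj d).obj ⟶ (Y d).obj) : ∃ d s, p.IsGerm t y d s := by
  obtain ⟨d, x, hx⟩ := hF.exists_rep_reducedProduct
    (F.map (ObjectProperty.homMk (p.toReducedProduct y) : X ⟶ reducedProduct Y) t)
  exact ⟨d, _, x, fun _ _ ↦ rfl, hx⟩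

theorem IsGerm.eventually_eq (hF : IsPlus F) {t : F.obj X} {Y Z : p.D → L.FullSubcategory}
    {y : ∀ d, (p.diag.obj d).obj ⟶ (Y d).obj} {z : ∀ d, (p.diag.obj d).obj ⟶ (Z d).obj}
    {d e : p.D} {s : ∀ i, d ≤ i → F.obj (Y i)} {s' : ∀ i, e ≤ i → F.obj (Z i)}
    (hs : p.IsGerm t y d s) (hs' : p.IsGerm t z e s') (f : ∀ i, Y i ⟶ Z i)
    (hf : ∀ i, y i ≫ (f i).hom = z i) :
    ∃ c, d ≤ c ∧ e ≤ c ∧ ∀ (i : p.D) (h₁ : d ≤ i) (h₂ : e ≤ i), c ≤ i →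
      F.map (f i) (s i h₁) = s' i h₂ := by
  obtain ⟨x, hx, hxt⟩ := hs
  obtain ⟨x', hx', hxt'⟩ := hs'
  have hfac : (ObjectProperty.homMk (p.toReducedProduct y) : X ⟶ reducedProduct Y) ≫
      reducedProduct.map f = ObjectProperty.homMk (p.toReducedProduct z) := by
    ext
    refine p.hom_ext fun i ↦ ?_
    obtain ⟨l, hl⟩ := exists_hom_tailProducts (L := L) (Y := Y) (d := i)
      fun e h ↦ (p.diag.map (homOfLE h)).hom ≫ y e
    change p.incl i ≫ p.toReducedProduct y ≫ (reducedProduct.map f).hom =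
      p.incl i ≫ p.toReducedProduct z
    rw [p.incl_toReducedProduct z i (l ≫ ((tailProducts.map f).app i).hom), ← Category.assoc,
      p.incl_toReducedProduct y i l hl, Category.assoc, Category.assoc,
      ← ObjectProperty.FullSubcategory.comp_hom, reducedProduct.ι_map]
    · rfl
    · intro e h
      rw [Category.assoc, ← ObjectProperty.FullSubcategory.comp_hom, tailProducts.map_app_π,
        ObjectProperty.FullSubcategory.comp_hom, ← Category.assoc, hl, Category.assoc, hf]
  obtain ⟨c, hc₁, hc₂, hc⟩ := hF.exists_eq_reducedProduct
    (x := F.map ((tailProducts.map f).app d) x) (y := x') (by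
      rw [hxt', ← hfac, Functor.map_comp_apply, ← hxt, ← Functor.map_comp_apply,
        ← Functor.map_comp_apply, reducedProduct.ι_map])
  refine ⟨c, hc₁, hc₂, fun i h₁ h₂ h ↦ ?_⟩
  rw [← hx, ← hx', ← hc i h₁ h₂ h, ← Functor.map_comp_apply, ← Functor.map_comp_apply,
    tailProducts.map_app_π]

theorem isGerm_const (t : F.obj X) (d : p.D) :
    p.IsGerm t (Y := fun _ ↦ X) (fun i ↦ p.incl i) d fun _ _ ↦ t := by
  obtain ⟨f, hf⟩ := tailProducts.exists_lift (Y := fun _ : p.D ↦ X) (d := d) fun _ _ ↦ 𝟙 X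
  refine ⟨F.map f t, fun e h ↦ ?_, ?_⟩
  · rw [← Functor.map_comp_apply, hf, Functor.map_id_apply]
  · rw [← Functor.map_comp_apply]
    congr 2
    congr 1
    ext
    have hw {i j : p.D} (k : i ⟶ j) := p.w k
    refine p.hom_ext fun i ↦ ?_
    obtain ⟨j, hij, hdj⟩ := exists_ge_ge i d
    rw [← hw (homOfLE hij), Category.assoc, Category.assoc]
    congr 1
    refine (Eq.trans ?_ (p.incl_toReducedProduct (Y := fun _ ↦ X) (fun i ↦ p.incl i) j
      (p.incl j ≫ f.hom ≫ ((tailProducts fun _ ↦ X).map (homOfLE hdj)).hom) ?_).symm)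
    · rw [← reducedProduct.w _ (homOfLE hdj)]
      simp
    · intro e h
      have := congr(($(tailProducts.map_π (fun _ ↦ X) (homOfLE hdj) h)).hom)
      rw [ObjectProperty.FullSubcategory.comp_hom] at this
      rw [Category.assoc, Category.assoc, this, ← ObjectProperty.FullSubcategory.comp_hom, hf, hw]
      exact Category.comp_id _

theorem isGerm_natTrans {d : p.D} (σ : homFunctor L (p.diag.obj d).obj ⟶ F)
    {Y : p.D → L.FullSubcategory} (y : ∀ d, (p.diag.obj d).obj ⟶ (Y d).obj) :
    p.IsGerm (σ.app X (p.incl d)) y d fun e h ↦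
      σ.app (Y e) ((p.diag.map (homOfLE h)).hom ≫ y e) := by
  obtain ⟨l, hl⟩ := exists_hom_tailProducts (L := L) (Y := Y) (d := d)
    fun e h ↦ (p.diag.map (homOfLE h)).hom ≫ y e
  refine ⟨σ.app _ l, fun e h ↦ ?_, ?_⟩
  · rw [map_app_homFunctor, hl]
  · rw [map_app_homFunctor, map_app_homFunctor, ← p.incl_toReducedProduct y d l hl]
    rfl

end DirectedPresentation

/-- Every element of a functor preserving products and directed colimits is the image of a
morphism from a finitely presentable object. -/
theorem IsPlus.exists_cover (hF : IsPlus F) {X : L.FullSubcategory} (t : F.obj X) :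
    ∃ (A : Fp K) (a : A.obj ⟶ X.obj) (τ : homFunctor L A.obj ⟶ F), τ.app X a = t := by
  obtain ⟨p⟩ := exists_directedPresentation X.obj
  choose W c hc using fun A : Fp K ↦ exists_weaklyInitial (L := L) A
  let Y (d : p.D) := W (p.diag.obj d)
  let y (d : p.D) : (p.diag.obj d).obj ⟶ (Y d).obj := c _
  obtain ⟨d, s, hs⟩ := p.exists_isGerm hF t y
  let good (i : p.D) (h : d ≤ i) : Prop := ∀ (Z : L.FullSubcategory) (f g : Y i ⟶ Z),
    y i ≫ f.hom = y i ≫ g.hom → F.map f (s i h) = F.map g (s i h)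
  -- `f` and `g` are a counterexample to `good i` if there is one, and identities otherwise. Their
  -- images of the germ of `t` represent `t` over the same maps to `Z i`, so they eventually agree
  -- and `good` holds for large `i`.
  have key (i : p.D) : ∃ (Z : L.FullSubcategory) (f g : Y i ⟶ Z), y i ≫ f.hom = y i ≫ g.hom ∧
      ∀ h : d ≤ i, F.map f (s i h) = F.map g (s i h) → good i h := by
    by_cases h : ∃ h, ¬ good i h
    · obtain ⟨h, hi⟩ := h
      simp only [good, not_forall] at hi
      obtain ⟨Z, f, g, hfg, hne⟩ := hi
      exact ⟨Z, f, g, hfg, fun _ h ↦ (hne h).elim⟩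
    · exact ⟨Y i, 𝟙 _, 𝟙 _, rfl, fun h' _ ↦ by_contra fun hb ↦ h ⟨h', hb⟩⟩
  choose Z f g hfg hZ using key
  choose r hr using fun i ↦ hc _ X (p.incl i)
  obtain ⟨e, s', hs'⟩ := p.exists_isGerm hF t fun i ↦ y i ≫ (f i).hom
  obtain ⟨c₁, hd₁, he₁, h₁⟩ := hs.eventually_eq hF hs' f fun _ ↦ rfl
  obtain ⟨c₂, hd₂, he₂, h₂⟩ := hs.eventually_eq hF hs' g fun i ↦ (hfg i).symm
  -- Comparison with the constant family ensures that the transformation built from `s j` sends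
  -- `p.incl j` to `t` itself.
  obtain ⟨c₃, hd₃, -, h₃⟩ := hs.eventually_eq hF (p.isGerm_const t d) r hr
  obtain ⟨i, hi₁, hi₂⟩ := exists_ge_ge c₁ c₂
  obtain ⟨j, hj, hj₃⟩ := exists_ge_ge i c₃
  have hdj := hd₃.trans hj₃
  have hej := he₁.trans (hi₁.trans hj)
  obtain ⟨τ, hτ⟩ := exists_natTrans_of_weaklyInitial (F := F) (hc (p.diag.obj j))
    (hZ j hdj ((h₁ j hdj hej (hi₁.trans hj)).trans (h₂ j hdj hej (hi₂.trans hj)).symm))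
  exact ⟨p.diag.obj j, p.incl j, τ, by rw [← hr j, hτ, h₃ j hdj hdj hj₃]⟩

/-- Two natural transformations that agree on one element agree on a neighbourhood of it. -/
theorem IsPlus.exists_eq_of_app_eq (hF : IsPlus F) {A : Fp K} (σ τ : homFunctor L A.obj ⟶ F)
    {X : L.FullSubcategory} (a : A.obj ⟶ X.obj) (h : σ.app X a = τ.app X a) :
    ∃ (B : Fp K) (f : A ⟶ B) (b : B.obj ⟶ X.obj), f.hom ≫ b = a ∧
      homFunctorMap L f ≫ σ = homFunctorMap L f ≫ τ := by
  obtain ⟨p⟩ := exists_directedPresentation X.obj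
  obtain ⟨d, l, rfl⟩ := p.exists_lift A a
  by_contra! H
  -- At each stage above `d` a point is chosen where `σ` and `τ` differ. These values are two germs
  -- of the same element of `F(X)`, so they cannot differ at all large stages.
  have key (i : p.D) : ∃ (Y : L.FullSubcategory) (y : (p.diag.obj i).obj ⟶ Y.obj),
      ∀ h : d ≤ i, σ.app Y (l.hom ≫ (p.diag.map (homOfLE h)).hom ≫ y) ≠
        τ.app Y (l.hom ≫ (p.diag.map (homOfLE h)).hom ≫ y) := by
    by_cases hdi : d ≤ i
    · by_contra! hi
      refine H (p.diag.obj i) (l ≫ p.diag.map (homOfLE hdi)) (p.incl i) ?_ ?_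
      · rw [ObjectProperty.FullSubcategory.comp_hom, Category.assoc, p.w]
      · refine homFunctor_hom_ext fun Y y ↦ ?_
        obtain ⟨_, hi⟩ := hi Y y
        change σ.app Y ((l ≫ p.diag.map (homOfLE hdi)).hom ≫ y) =
          τ.app Y ((l ≫ p.diag.map (homOfLE hdi)).hom ≫ y)
        rw [ObjectProperty.FullSubcategory.comp_hom, Category.assoc, hi]
    · obtain ⟨W, c, -⟩ := exists_weaklyInitial (L := L) (p.diag.obj i)
      exact ⟨W, c, fun h ↦ (hdi h).elim⟩
  choose Y y hy using key
  have hσ := p.isGerm_natTrans (homFunctorMap L l ≫ σ) y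
  have hτ := p.isGerm_natTrans (homFunctorMap L l ≫ τ) y
  have e : (homFunctorMap L l ≫ σ).app X (p.incl d) = (homFunctorMap L l ≫ τ).app X (p.incl d) := h
  rw [← e] at hτ
  obtain ⟨c, hc, -, hc'⟩ := hσ.eventually_eq hF hτ (fun i ↦ 𝟙 (Y i)) fun i ↦ Category.comp_id _
  have := hc' c hc hc le_rfl
  rw [Functor.map_id_apply] at this
  exact hy c hc this

/-- Lifting of natural transformations along a surjective one, up to morphisms with respect to
which the objects of `L` are injective. -/
theorem IsPlus.exists_lift (hF : IsPlus F) {A C : Fp K} (σ : homFunctor L C.obj ⟶ F)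
    (τ : homFunctor L A.obj ⟶ F) (hτ : ∀ X, Function.Surjective (τ.app X)) :
    ∃ (B : Fp K) (h : C ⟶ B) (k : A ⟶ B), injMorphisms L h ∧
      homFunctorMap L h ≫ σ = homFunctorMap L k ≫ τ := by
  obtain ⟨W, c, hc⟩ := exists_weaklyInitial (L := L) C
  obtain ⟨a, ha⟩ := hτ W (σ.app W c)
  -- Both transformations are restricted to the coproduct and made equal near the point `(c, a)` of
  -- `W`. The resulting `C ⟶ B` lies in `injMorphisms L` because `c` factors through it and every
  -- map from `C` to an object of `L` factors through `c`.
  obtain ⟨S, i, j, hS, -⟩ := exists_coprod_fp C A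
  obtain ⟨x, hi, hj⟩ := hS c a
  obtain ⟨B, f, b, hb, h⟩ := hF.exists_eq_of_app_eq (homFunctorMap L i ≫ σ)
    (homFunctorMap L j ≫ τ) x (by
      change σ.app W (i.hom ≫ x) = τ.app W (j.hom ≫ x)
      rw [hi, hj, ha])
  refine ⟨B, i ≫ f, j ≫ f, fun X hX y ↦ ?_, by
    rw [homFunctorMap_comp, homFunctorMap_comp, Category.assoc, Category.assoc, h]⟩
  obtain ⟨g, hg⟩ := hc ⟨X, hX⟩ y
  refine ⟨b ≫ g.hom, ?_⟩
  rw [← hg, ← hi, ← hb]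
  simp

instance small_natTrans (A : Fp K) (F : L.FullSubcategory ⥤ Type w) :
    Small.{w} (homFunctor L A.obj ⟶ F) := by
  obtain ⟨W, c, hc⟩ := exists_weaklyInitial (L := L) A
  refine small_of_injective (f := fun τ : homFunctor L A.obj ⟶ F ↦ τ.app W c) fun σ τ h ↦ ?_
  refine homFunctor_hom_ext fun X a ↦ ?_
  obtain ⟨f, rfl⟩ := hc X a
  rw [← map_app_homFunctor, ← map_app_homFunctor]
  exact congr(F.map f $h)

/-- A functor preserving products and directed colimits is covered by a single `Hom(A, -)`. -/
theorem IsPlus.exists_surjective (hF : IsPlus F) :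
    ∃ (A : Fp K) (τ : homFunctor L A.obj ⟶ F), ∀ X, Function.Surjective (τ.app X) := by
  let E := (equivSmallModel.{w} (Fp K)).inverse
  let I : Type w := Σ A : SmallModel.{w} (Fp K), Shrink.{w} (homFunctor L (E.obj A).obj ⟶ F)
  let σ (i : I) : homFunctor L (E.obj i.1).obj ⟶ F := (equivShrink _).symm i.2
  have hσ {X : L.FullSubcategory} (t : F.obj X) : ∃ i a, (σ i).app X a = t := by
    obtain ⟨A, a, τ, rfl⟩ := hF.exists_cover t
    let e := (equivSmallModel.{w} (Fp K)).unitIso.app A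
    refine ⟨⟨(equivSmallModel.{w} (Fp K)).functor.obj A,
      equivShrink _ (homFunctorMap L e.hom ≫ τ)⟩, e.inv.hom ≫ a, ?_⟩
    simp only [σ, Equiv.symm_apply_apply]
    change τ.app X (e.hom.hom ≫ e.inv.hom ≫ a) = τ.app X a
    congr 1
    rw [← Category.assoc, ← ObjectProperty.FullSubcategory.comp_hom, e.hom_inv_id]
    exact Category.id_comp _
  -- If every `σ i` misses some `t i`, these form one element of `F` at the product of the `X i`.
  -- Some `σ i` hits that element, hence also its projection `t i`.
  by_contra! H
  have key (i : I) : ∃ X, ∃ t : F.obj X, ∀ a, (σ i).app X a ≠ t := by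
    obtain ⟨X, h⟩ := H _ (σ i)
    simp only [Function.Surjective, not_forall, not_exists] at h
    obtain ⟨t, ht⟩ := h
    exact ⟨X, t, ht⟩
  choose X t ht using key
  obtain ⟨x, hx, -⟩ := hF.existsUnique (productIsProduct X) t
  obtain ⟨i, a, rfl⟩ := hσ x
  exact ht i _ ((map_app_homFunctor (σ i) (Pi.π X i) a).symm.trans (hx i))

end Covers

end DefinableCat

namespace DefinableCat

/-! ### Covering sieves of the regular coverage -/

section Topology

variable {K : Type u} [Category.{w} K] [IsLocallyFinitelyPresentable.{w} K]
  {L : ObjectProperty K}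

theorem injMorphisms_id (A : Fp K) : injMorphisms L (𝟙 A) :=
  fun _ _ a ↦ ⟨a, Category.id_comp _⟩

theorem injMorphisms_comp {A B C : Fp K} {f : A ⟶ B} {g : B ⟶ C} (hf : injMorphisms L f)
    (hg : injMorphisms L g) : injMorphisms L (f ≫ g) := fun X hX a ↦ by
  obtain ⟨b, rfl⟩ := hf hX a
  obtain ⟨c, rfl⟩ := hg hX b
  exact ⟨c, Category.assoc _ _ _⟩

theorem exists_injMorphisms_of_saturate {X : (Fp K)ᵒᵖ} {S : Sieve X}
    (hS : (coverage L).Saturate X S) :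
    ∃ (B : Fp K) (h : X.unop ⟶ B), injMorphisms L h ∧ S h.op := by
  induction hS with
  | of X S hS =>
    obtain ⟨Y, f, hf, rfl⟩ := hS
    exact ⟨Y.unop, f.unop, hf, ⟨_, 𝟙 _, f, ⟨⟩, Category.id_comp _⟩⟩
  | top X => exact ⟨X.unop, 𝟙 _, injMorphisms_id _, trivial⟩
  | transitive X R S _ _ ih₁ ih₂ =>
    obtain ⟨B, h, hh, hR⟩ := ih₁
    obtain ⟨C, g, hg, hS⟩ := ih₂ hR
    exact ⟨C, h ≫ g, injMorphisms_comp hh hg, hS⟩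

theorem mem_coverage_iff {A : Fp K} (S : Sieve (op A)) :
    S ∈ (coverage L).toGrothendieck (op A) ↔
      ∃ (B : Fp K) (h : A ⟶ B), injMorphisms L h ∧ S h.op := by
  constructor
  · exact exists_injMorphisms_of_saturate
  · rintro ⟨B, h, hh, hS⟩
    exact (coverage L).mem_toGrothendieck_sieves_of_superset (R := Presieve.singleton h.op)
      (by rintro _ _ ⟨⟩; exact hS) ⟨op B, h.op, hh, rfl⟩

theorem FunTopos.ext_of_injMorphisms (Q : FunTopos L) {A B : Fp K} {h : A ⟶ B}
    (hh : injMorphisms L h) {x y : Q.obj.obj (op (op A))}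
    (hxy : Q.obj.map h.op.op x = Q.obj.map h.op.op y) : x = y := by
  refine (((isSheaf_iff_isSheaf_of_type _ _).1 Q.property).isSeparated _
    ((coverage L).mem_toGrothendieck_sieves_of_superset (R := Presieve.singleton h.op)
      (Sieve.le_generate _) ⟨op B, h.op, hh, rfl⟩)).ext ?_
  rintro Y _ ⟨_, k, _, ⟨⟩, rfl⟩
  rw [op_comp, Functor.map_comp_apply, Functor.map_comp_apply, hxy]

end Topology

/-! ### The sheaf of natural transformations; full faithfulness -/

section NatSheaf

variable {K : Type u} [Category.{w} K] [IsLocallyFinitelyPresentable.{w} K]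
  {L : ObjectProperty K} [hL : Fact (IsDefinable L)]

/-- The presheaf of natural transformations from the functors `Hom(A, -)` to a given functor. -/
noncomputable def natPresheaf (F : L.FullSubcategory ⥤ Type w) : (Fp K)ᵒᵖᵒᵖ ⥤ Type w where
  obj A := Shrink.{w} (homFunctor L A.unop.unop.obj ⟶ F)
  map f := TypeCat.ofHom fun s ↦
    equivShrink _ (homFunctorMap L f.unop.unop ≫ (equivShrink _).symm s)
  map_id A := by
    refine ConcreteCategory.hom_ext _ _ fun s ↦ ?_
    change equivShrink _ (homFunctorMap L (𝟙 A.unop.unop) ≫ (equivShrink _).symm s) = s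
    rw [homFunctorMap_id, Category.id_comp, Equiv.apply_symm_apply]
  map_comp f g := by
    refine ConcreteCategory.hom_ext _ _ fun s ↦ ?_
    change equivShrink _ (homFunctorMap L (f.unop.unop ≫ g.unop.unop) ≫ _) =
      equivShrink _ (homFunctorMap L g.unop.unop ≫ (equivShrink _).symm (equivShrink _ _))
    rw [Equiv.symm_apply_apply, homFunctorMap_comp, Category.assoc]

variable {F G : L.FullSubcategory ⥤ Type w}

/-- The sections of `natPresheaf F` are natural transformations. -/
noncomputable def natEquiv {A : Fp K} :
    (natPresheaf F).obj (op (op A)) ≃ (homFunctor L A.obj ⟶ F) :=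
  (equivShrink _).symm

theorem natEquiv_map {A B : Fp K} (h : A ⟶ B) (s : (natPresheaf F).obj (op (op A))) :
    natEquiv ((natPresheaf F).map h.op.op s) = homFunctorMap L h ≫ natEquiv s :=
  Equiv.symm_apply_apply _ _

theorem natPresheaf_map_symm {A B : Fp K} (h : A ⟶ B) (τ : homFunctor L A.obj ⟶ F) :
    (natPresheaf F).map h.op.op (natEquiv.symm τ) = natEquiv.symm (homFunctorMap L h ≫ τ) := by
  apply natEquiv.injective
  rw [natEquiv_map, Equiv.apply_symm_apply, Equiv.apply_symm_apply]

theorem exists_amalgamation {A B : Fp K} {h : A ⟶ B} (hh : injMorphisms L h)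
    (σ : homFunctor L B.obj ⟶ F)
    (hσ : ∀ (C : Fp K) (f g : B ⟶ C), h ≫ f = h ≫ g → homFunctorMap L f ≫ σ = homFunctorMap L g ≫ σ) :
    ∃ τ : homFunctor L A.obj ⟶ F, homFunctorMap L h ≫ τ = σ := by
  -- Two points of `B` agreeing on `A` form one point of the cokernel pair of `h`, where
  -- compatibility of `σ` applies.
  have key {X : L.FullSubcategory} (b c : B.obj ⟶ X.obj) (hbc : h.hom ≫ b = h.hom ≫ c) :
      σ.app X b = σ.app X c := by
    obtain ⟨P, i, j, hij, hP⟩ := exists_pushout_fp h h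
    obtain ⟨p, rfl, rfl⟩ := hP b c hbc
    exact congr(($(hσ P i j hij)).app X p)
  choose b hb using fun (X : L.FullSubcategory) (a : A.obj ⟶ X.obj) ↦ hh X.property a
  refine ⟨{ app := fun X ↦ TypeCat.ofHom fun a ↦ σ.app X (b X a)
            naturality := fun X Y f ↦ ?_ }, homFunctor_hom_ext fun X c ↦ key _ _ (hb _ _)⟩
  ext a
  change σ.app Y (b Y (a ≫ f.hom)) = F.map f (σ.app X (b X a))
  rw [map_app_homFunctor]
  exact key _ _ (by rw [hb, ← Category.assoc, hb])

theorem isSheaf_natPresheaf (F : L.FullSubcategory ⥤ Type w) :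
    Presheaf.IsSheaf (coverage L).toGrothendieck (natPresheaf F) := by
  rw [isSheaf_iff_isSheaf_of_type, Presieve.isSheaf_coverage]
  rintro ⟨A⟩ _ ⟨⟨B⟩, h, hh, rfl⟩
  rw [Presieve.isSheafFor_singleton]
  intro x hx
  obtain ⟨τ, hτ⟩ := exists_amalgamation hh (natEquiv x) fun C f g hfg ↦ by
    rw [← natEquiv_map, ← natEquiv_map]
    exact congr(natEquiv $(hx f.op g.op congr(($hfg).op)))
  refine ⟨natEquiv.symm τ, ?_, fun y hy ↦ ?_⟩
  · apply natEquiv.injective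
    exact (natEquiv_map h.unop _).trans (by rw [Equiv.apply_symm_apply, hτ])
  · apply natEquiv.injective
    rw [Equiv.apply_symm_apply]
    refine homFunctor_hom_ext fun X a ↦ ?_
    obtain ⟨b, rfl⟩ := hh X.property a
    have h₁ : homFunctorMap L h.unop ≫ natEquiv y = homFunctorMap L h.unop ≫ τ := by
      rw [hτ, ← natEquiv_map]
      exact congr(natEquiv $hy)
    exact congr(($h₁).app X b)

variable (L) in
/-- The functor sending a functor on `L` to the sheaf of natural transformations to it. -/
noncomputable def natSheaf : Plus.{w} L.FullSubcategory ⥤ FunTopos L where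
  obj F := ⟨natPresheaf F.obj, isSheaf_natPresheaf F.obj⟩
  map {F G} α := ObjectProperty.homMk
    { app := fun A ↦ TypeCat.ofHom fun s ↦
        equivShrink _ ((equivShrink (homFunctor L A.unop.unop.obj ⟶ F.obj)).symm s ≫ α.hom)
      naturality := fun A B f ↦ by
        ext s
        change natEquiv.symm (natEquiv (natEquiv.symm (homFunctorMap L f.unop.unop ≫
          natEquiv s)) ≫ α.hom) = natEquiv.symm (homFunctorMap L f.unop.unop ≫
            natEquiv (natEquiv.symm (natEquiv s ≫ α.hom)))
        simp only [Equiv.apply_symm_apply, Category.assoc] }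
  map_id F := by
    ext A s
    exact (congrArg _ (Category.comp_id _)).trans (Equiv.apply_symm_apply _ _)
  map_comp {F G H} α β := by
    ext A s
    change natEquiv.symm (natEquiv s ≫ α.hom ≫ β.hom) =
      natEquiv.symm (natEquiv (natEquiv.symm (natEquiv s ≫ α.hom)) ≫ β.hom)
    rw [Equiv.apply_symm_apply, Category.assoc]

theorem natEquiv_natSheaf_map {F G : Plus.{w} L.FullSubcategory} (α : F ⟶ G) {A : Fp K}
    (s : (natPresheaf F.obj).obj (op (op A))) :
    natEquiv (((natSheaf L).map α).hom.app (op (op A)) s) = natEquiv s ≫ α.hom :=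
  Equiv.symm_apply_apply _ _

instance : (natSheaf L).Faithful where
  map_injective {F G} α β h := by
    ext X t
    obtain ⟨A, a, τ, rfl⟩ := ((isPlus_iff _).1 F.property).exists_cover t
    have h' := congr(natEquiv (($h).hom.app (op (op A)) (natEquiv.symm τ)))
    rw [natEquiv_natSheaf_map, natEquiv_natSheaf_map, Equiv.apply_symm_apply] at h'
    exact congr(($h').app X a)

instance : (natSheaf L).Full where
  map_surjective {F G} θ := by
    have hF := (isPlus_iff _).1 F.property
    let θ' {A : Fp K} (τ : homFunctor L A.obj ⟶ F.obj) : homFunctor L A.obj ⟶ G.obj :=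
      natEquiv (θ.hom.app (op (op A)) (natEquiv.symm τ))
    have hθ' {A B : Fp K} (h : A ⟶ B) (τ : homFunctor L A.obj ⟶ F.obj) :
        θ' (homFunctorMap L h ≫ τ) = homFunctorMap L h ≫ θ' τ :=
      congr(natEquiv (θ.hom.app (op (op B)) $(natPresheaf_map_symm h τ))).symm.trans
        (congr(natEquiv $(NatTrans.naturality_apply θ.hom h.op.op (natEquiv.symm τ))).trans
          (natEquiv_map _ _))
    -- The preimage of `θ` must send `τ.app X a` to `(θ' τ).app X a`. Independence of the
    -- representation holds because two representations become restrictions of one transformation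
    -- near the common point.
    have key {A B : Fp K} (σ : homFunctor L A.obj ⟶ F.obj) (τ : homFunctor L B.obj ⟶ F.obj)
        {X : L.FullSubcategory} (a : A.obj ⟶ X.obj) (b : B.obj ⟶ X.obj)
        (h : σ.app X a = τ.app X b) : (θ' σ).app X a = (θ' τ).app X b := by
      obtain ⟨S, i, j, hS, -⟩ := exists_coprod_fp A B
      obtain ⟨x, rfl, rfl⟩ := hS a b
      obtain ⟨C, f, c, rfl, hf⟩ := hF.exists_eq_of_app_eq (homFunctorMap L i ≫ σ)
        (homFunctorMap L j ≫ τ) x h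
      have := congr((θ' $hf).app X c)
      rw [hθ', hθ', hθ', hθ'] at this
      exact this
    choose A a τ hτ using fun (X : L.FullSubcategory) (t : F.obj.obj X) ↦ hF.exists_cover t
    refine ⟨ObjectProperty.homMk
      { app := fun X ↦ TypeCat.ofHom fun t ↦ (θ' (τ X t)).app X (a X t)
        naturality := fun X Y f ↦ ?_ }, ?_⟩
    · ext t
      change (θ' (τ Y (F.obj.map f t))).app Y (a Y (F.obj.map f t)) =
        G.obj.map f ((θ' (τ X t)).app X (a X t))
      rw [map_app_homFunctor]
      refine key _ _ _ _ ?_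
      rw [hτ, ← map_app_homFunctor, hτ]
    · ext ⟨⟨B⟩⟩ s
      apply natEquiv.injective
      refine (natEquiv_natSheaf_map _ _).trans (homFunctor_hom_ext fun X b ↦ ?_)
      have : natEquiv (θ.hom.app (op (op B)) s) = θ' (natEquiv s) :=
        congr(natEquiv (θ.hom.app (op (op B)) $(natEquiv.symm_apply_apply s))).symm
      refine Eq.trans ?_ congr(($this).app X b).symm
      exact key _ _ _ _ (hτ _ _)

end NatSheaf

end DefinableCat

namespace DefinableCat

/-! ### Supercompact sheaves are those generated by one section -/

section Supercompact

variable {K : Type u} [Category.{w} K] [IsLocallyFinitelyPresentable.{w} K]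
  {L : ObjectProperty K}

variable (L) in
instance hasSheafify_coverage : HasSheafify (coverage L).toGrothendieck (Type w) :=
  hasSheafifyEssentiallySmallSite.{w} _ _

variable (L) in
instance wEqualsLocallyBijective_coverage :
    (coverage L).toGrothendieck.WEqualsLocallyBijective (Type w) :=
  GrothendieckTopology.WEqualsLocallyBijective.ofEssentiallySmall.{w} _

theorem map_op_op_comp_apply (Q : (Fp K)ᵒᵖᵒᵖ ⥤ Type w) {A B C : Fp K} (f : A ⟶ B) (g : B ⟶ C)
    (x : Q.obj (op (op A))) : Q.map (f ≫ g).op.op x = Q.map g.op.op (Q.map f.op.op x) :=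
  Functor.map_comp_apply Q f.op.op g.op.op x

theorem isLocallySurjective_iff {P Q : (Fp K)ᵒᵖᵒᵖ ⥤ Type w} (f : P ⟶ Q) :
    Presheaf.IsLocallySurjective (coverage L).toGrothendieck f ↔
      ∀ (A : Fp K) (r : Q.obj (op (op A))), ∃ (B : Fp K) (h : A ⟶ B) (x : P.obj (op (op B))),
        injMorphisms L h ∧ f.app _ x = Q.map h.op.op r := by
  constructor
  · intro hf A r
    obtain ⟨B, h, hh, x, hx⟩ :=
      (mem_coverage_iff _).1 (Presheaf.imageSieve_mem (coverage L).toGrothendieck f r)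
    exact ⟨B, h, x, hh, hx⟩
  · intro hf
    refine ⟨fun {A} r ↦ ?_⟩
    obtain ⟨B, h, x, hh, hx⟩ := hf A.unop r
    exact (mem_coverage_iff _).2 ⟨B, h, hh, x, hx⟩

theorem FunTopos.epi_iff {P Q : FunTopos L} (f : P ⟶ Q) :
    Epi f ↔ ∀ (A : Fp K) (r : Q.obj.obj (op (op A))), ∃ (B : Fp K) (h : A ⟶ B)
      (x : P.obj.obj (op (op B))), injMorphisms L h ∧ f.hom.app _ x = Q.obj.map h.op.op r := by
  rw [← Sheaf.isLocallySurjective_iff_epi, ← isLocallySurjective_iff]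

/-- The subsheaf of a sheaf generated by a subpresheaf. -/
def FunTopos.closure (Q : FunTopos L) (S : Subfunctor Q.obj) : FunTopos L :=
  ⟨(S.sheafify (coverage L).toGrothendieck).toFunctor, (isSheaf_iff_isSheaf_of_type _ _).2
    (S.sheafify_isSheaf ((isSheaf_iff_isSheaf_of_type _ _).1 Q.property))⟩

/-- The inclusion of a generated subsheaf. -/
def FunTopos.closureι (Q : FunTopos L) (S : Subfunctor Q.obj) : Q.closure S ⟶ Q :=
  ObjectProperty.homMk (Subfunctor.ι _)

theorem FunTopos.exists_of_epi_closureι (Q : FunTopos L) (S : Subfunctor Q.obj)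
    [Epi (Q.closureι S)] {A : Fp K} (r : Q.obj.obj (op (op A))) :
    ∃ (B : Fp K) (h : A ⟶ B), injMorphisms L h ∧ Q.obj.map h.op.op r ∈ S.obj (op (op B)) := by
  obtain ⟨B, h, ⟨x, hx⟩, hh, rfl : x = _⟩ := (FunTopos.epi_iff (Q.closureι S)).1 inferInstance A r
  obtain ⟨C, g, hg, hx⟩ := (mem_coverage_iff _).1 hx
  refine ⟨C, h ≫ g, injMorphisms_comp hh hg, ?_⟩
  rw [map_op_op_comp_apply]
  exact hx

/-- The subsheaf generated by the union of the images has an epimorphic inclusion, and epimorphisms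
of sheaves are locally surjective. A covering sieve contains a single member of `injMorphisms L`, so
one index `i` suffices for `r`. -/
theorem FunTopos.exists_of_jointlyEpic {Q : FunTopos L} {I : Type w} {P : I → FunTopos L}
    {f : ∀ i, P i ⟶ Q} (hf : JointlyEpic f) {A : Fp K} (r : Q.obj.obj (op (op A))) :
    ∃ (B : Fp K) (h : A ⟶ B) (i : I) (x : (P i).obj.obj (op (op B))),
      injMorphisms L h ∧ (f i).hom.app _ x = Q.obj.map h.op.op r := by
  let S : Subfunctor Q.obj := ⨆ i, Subfunctor.range (f i).hom
  have : Epi (Q.closureι S) := ⟨fun {Z} g₁ g₂ h ↦ hf g₁ g₂ fun i ↦ by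
    ext A x
    have hx : (f i).hom.app A x ∈ (S.sheafify (coverage L).toGrothendieck).obj A :=
      S.le_sheafify _ _ (by
        simp only [S, Subfunctor.iSup_obj, Set.mem_iUnion]
        exact ⟨i, x, rfl⟩)
    exact congr(($h).hom.app A ⟨_, hx⟩)⟩
  obtain ⟨B, h, hh, hr⟩ := Q.exists_of_epi_closureι S r
  simp only [S, Subfunctor.iSup_obj, Set.mem_iUnion] at hr
  obtain ⟨i, x, hx⟩ := hr
  exact ⟨B, h, i, x, hh, hx⟩

/-- A section `q` generates a sheaf if every section is locally a restriction of `q`. -/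
def IsGenerator (Q : (Fp K)ᵒᵖᵒᵖ ⥤ Type w) (L : ObjectProperty K) {A : Fp K}
    (q : Q.obj (op (op A))) : Prop :=
  ∀ (B : Fp K) (r : Q.obj (op (op B))), ∃ (C : Fp K) (h : B ⟶ C) (k : A ⟶ C),
    injMorphisms L h ∧ Q.map h.op.op r = Q.map k.op.op q

theorem IsGenerator.of_map {Q : (Fp K)ᵒᵖᵒᵖ ⥤ Type w} {A B : Fp K} {q : Q.obj (op (op A))}
    (hq : IsGenerator Q L q) {h : A ⟶ B} (hh : injMorphisms L h) :
    IsGenerator Q L (Q.map h.op.op q) := by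
  intro C r
  obtain ⟨D, g, k, hg, hr⟩ := hq C r
  obtain ⟨P, i, j, hi, hij⟩ := exists_pushout_injMorphisms L h hh k
  refine ⟨P, g ≫ i, j, injMorphisms_comp hg hi, ?_⟩
  rw [map_op_op_comp_apply, hr, ← map_op_op_comp_apply, ← map_op_op_comp_apply, hij]

theorem isSupercompact_of_isGenerator {Q : FunTopos L} {A : Fp K} {q : Q.obj.obj (op (op A))}
    (hq : IsGenerator Q.obj L q) : IsSupercompact.{w} Q := by
  intro I P f hf
  obtain ⟨B, h, i, x, hh, hx⟩ := FunTopos.exists_of_jointlyEpic hf q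
  refine ⟨i, (FunTopos.epi_iff _).2 fun C r ↦ ?_⟩
  obtain ⟨D, g, k, hg, hr⟩ := hq.of_map hh C r
  refine ⟨D, g, (P i).obj.map k.op.op x, hg, ?_⟩
  rw [hr, ← hx]
  exact NatTrans.naturality_apply (f i).hom k.op.op x

/-- The subsheaves generated by single sections over a small model of `Fp K` are jointly epimorphic,
so one of them is everything. -/
theorem exists_isGenerator {Q : FunTopos L} (hQ : IsSupercompact.{w} Q) :
    ∃ (A : Fp K) (q : Q.obj.obj (op (op A))), IsGenerator Q.obj L q := by
  let E := equivSmallModel.{w} (Fp K)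
  let I : Type w := Σ A : SmallModel.{w} (Fp K), Q.obj.obj (op (op (E.inverse.obj A)))
  let S (i : I) : Subfunctor Q.obj := Subfunctor.ofSection i.2
  obtain ⟨i, hi⟩ := hQ I (fun i ↦ Q.closure (S i)) (fun i ↦ Q.closureι (S i)) (by
    intro Z g₁ g₂ h
    ext ⟨⟨A⟩⟩ r
    let e := E.unitIso.app A
    let i : I := ⟨E.functor.obj A, Q.obj.map e.hom.op.op r⟩
    have hr : r ∈ ((S i).sheafify (coverage L).toGrothendieck).obj (op (op A)) :=
      (S i).le_sheafify _ _ ⟨e.inv.op.op, by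
        change Q.obj.map e.inv.op.op (Q.obj.map e.hom.op.op r) = r
        rw [← map_op_op_comp_apply, e.hom_inv_id]
        exact Functor.map_id_apply Q.obj _ r⟩
    exact congr(($(h i)).hom.app _ ⟨r, hr⟩))
  refine ⟨_, i.2, fun B r ↦ ?_⟩
  obtain ⟨C, h, hh, k, hk⟩ := Q.exists_of_epi_closureι (S i) r
  exact ⟨C, h, k.unop.unop, hh, hk.symm⟩

theorem FunTopos.exists_of_isPullback {P Q Q' R : FunTopos L} {p : P ⟶ Q} {q : P ⟶ Q'}
    {f : Q ⟶ R} {g : Q' ⟶ R} (h : IsPullback p q f g) {A : Fp K} (x : Q.obj.obj (op (op A)))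
    (y : Q'.obj.obj (op (op A))) (hxy : f.hom.app _ x = g.hom.app _ y) :
    ∃ z : P.obj.obj (op (op A)), p.hom.app _ z = x ∧ q.hom.app _ z = y := by
  have := (h.map (sheafToPresheaf _ _)).map ((evaluation _ _).obj (op (op A)))
  exact Types.exists_of_isPullback this x y hxy

theorem FunTopos.ext_of_isPullback {P Q Q' R : FunTopos L} {p : P ⟶ Q} {q : P ⟶ Q'}
    {f : Q ⟶ R} {g : Q' ⟶ R} (h : IsPullback p q f g) {A : Fp K} {z z' : P.obj.obj (op (op A))}
    (h₁ : p.hom.app _ z = p.hom.app _ z') (h₂ : q.hom.app _ z = q.hom.app _ z') : z = z' := by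
  have := (h.map (sheafToPresheaf _ _)).map ((evaluation _ _).obj (op (op A)))
  exact Types.ext_of_isPullback this h₁ h₂

end Supercompact

/-! ### The sheaf of a functor in `L⁺` is regular -/

section Regular

variable {K : Type u} [Category.{w} K] [IsLocallyFinitelyPresentable.{w} K]
  {L : ObjectProperty K} [hL : Fact (IsDefinable L)] {F : L.FullSubcategory ⥤ Type w}

/-- The fibre product of two functors `Hom(A, -)`. -/
def fiberProduct {A B : Fp K} (σ : homFunctor L A.obj ⟶ F) (τ : homFunctor L B.obj ⟶ F) :
    L.FullSubcategory ⥤ Type w where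
  obj X := {x : (A.obj ⟶ X.obj) × (B.obj ⟶ X.obj) // σ.app X x.1 = τ.app X x.2}
  map {X Y} f := TypeCat.ofHom fun x ↦ ⟨(x.1.1 ≫ f.hom, x.1.2 ≫ f.hom), by
    dsimp only
    rw [← map_app_homFunctor, ← map_app_homFunctor, x.2]⟩
  map_id X := by
    refine ConcreteCategory.hom_ext _ _ fun x ↦ Subtype.ext (Prod.ext ?_ ?_)
    exacts [Category.comp_id _, Category.comp_id _]
  map_comp f g := by
    refine ConcreteCategory.hom_ext _ _ fun x ↦ Subtype.ext (Prod.ext ?_ ?_)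
    exacts [(Category.assoc _ _ _).symm, (Category.assoc _ _ _).symm]

section

variable {A B : Fp K} (σ : homFunctor L A.obj ⟶ F) (τ : homFunctor L B.obj ⟶ F)

/-- The first projection of a fibre product. -/
def fiberProduct.fst : fiberProduct σ τ ⟶ homFunctor L A.obj where
  app X := TypeCat.ofHom fun x ↦ x.1.1

/-- The second projection of a fibre product. -/
def fiberProduct.snd : fiberProduct σ τ ⟶ homFunctor L B.obj where
  app X := TypeCat.ofHom fun x ↦ x.1.2

variable {σ τ} in
theorem fiberProduct.exists_lift {G : L.FullSubcategory ⥤ Type w} (α : G ⟶ homFunctor L A.obj)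
    (β : G ⟶ homFunctor L B.obj) (h : α ≫ σ = β ≫ τ) :
    ∃ γ : G ⟶ fiberProduct σ τ, γ ≫ fst σ τ = α ∧ γ ≫ snd σ τ = β :=
  ⟨{ app X := TypeCat.ofHom fun x ↦ ⟨(α.app X x, β.app X x), congr(($h).app X x)⟩
     naturality X Y f := by
      refine ConcreteCategory.hom_ext _ _ fun x ↦ Subtype.ext (Prod.ext ?_ ?_)
      exacts [NatTrans.naturality_apply α f x, NatTrans.naturality_apply β f x] }, rfl, rfl⟩

theorem fiberProduct.condition : fst σ τ ≫ σ = snd σ τ ≫ τ := by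
  ext X x
  exact x.2

/-- Pullbacks of sets commute with products and with directed colimits. -/
theorem isPlus_fiberProduct (hF : IsPlus F) : IsPlus (fiberProduct σ τ) where
  existsUnique {I Y c} hc s := by
    obtain ⟨a, ha, ha'⟩ := homFunctor_existsUnique A.obj hc fun i ↦ (s i).1.1
    obtain ⟨b, hb, hb'⟩ := homFunctor_existsUnique B.obj hc fun i ↦ (s i).1.2
    refine ⟨⟨(a, b), ?_⟩, fun i ↦ Subtype.ext (Prod.ext (ha i) (hb i)), fun x hx ↦
      Subtype.ext (Prod.ext (ha' _ fun i ↦ congr(($(hx i)).1.1)) (hb' _ fun i ↦ congr(($(hx i)).1.2)))⟩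
    refine (hF.existsUnique hc fun i ↦ τ.app _ (s i).1.2).unique (fun i ↦ ?_) fun i ↦ ?_
    · exact (map_app_homFunctor σ _ a).trans (congr(σ.app _ $(ha i)).trans (s i).2)
    · exact (map_app_homFunctor τ _ b).trans congr(τ.app _ $(hb i))
  exists_rep {D} _ _ _ {Y c} hc x := by
    obtain ⟨d, a, ha⟩ := (isPlus_homFunctor A).exists_rep hc x.1.1
    obtain ⟨e, b, hb⟩ := (isPlus_homFunctor B).exists_rep hc x.1.2
    obtain ⟨f, hf₁, hf₂⟩ := exists_ge_ge d e
    have hw {i j : D} (k : i ⟶ j) : (Y.map k).hom ≫ (c.ι.app j).hom = (c.ι.app i).hom :=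
      congr(($(c.w k)).hom)
    obtain ⟨a, ha⟩ : ∃ a' : A.obj ⟶ (Y.obj f).obj, a' ≫ (c.ι.app f).hom = x.1.1 :=
      ⟨a ≫ (Y.map (homOfLE hf₁)).hom, by rw [Category.assoc, hw]; exact ha⟩
    obtain ⟨b, hb⟩ : ∃ b' : B.obj ⟶ (Y.obj f).obj, b' ≫ (c.ι.app f).hom = x.1.2 :=
      ⟨b ≫ (Y.map (homOfLE hf₂)).hom, by rw [Category.assoc, hw]; exact hb⟩
    obtain ⟨g, k, hk⟩ := hF.exists_eq hc f (σ.app _ a) (τ.app _ b) (by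
      rw [map_app_homFunctor, map_app_homFunctor, ha, hb]
      exact x.2)
    rw [map_app_homFunctor, map_app_homFunctor] at hk
    exact ⟨g, ⟨(a ≫ (Y.map k).hom, b ≫ (Y.map k).hom), hk⟩, Subtype.ext (Prod.ext
      ((Category.assoc _ _ _).trans (congr(a ≫ $(hw k)).trans ha))
      ((Category.assoc _ _ _).trans (congr(b ≫ $(hw k)).trans hb)))⟩
  exists_eq {D} _ _ _ {Y c} hc d x y h := by
    obtain ⟨e, k, hk⟩ := (isPlus_homFunctor A).exists_eq hc d x.1.1 y.1.1 congr(($h).1.1)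
    obtain ⟨f, l, hl⟩ := (isPlus_homFunctor B).exists_eq hc d x.1.2 y.1.2 congr(($h).1.2)
    obtain ⟨g, hg₁, hg₂⟩ := exists_ge_ge e f
    refine ⟨g, k ≫ homOfLE hg₁, Subtype.ext (Prod.ext ?_ ?_)⟩
    · change x.1.1 ≫ (Y.map (k ≫ homOfLE hg₁)).hom = y.1.1 ≫ (Y.map (k ≫ homOfLE hg₁)).hom
      rw [Y.map_comp, ObjectProperty.FullSubcategory.comp_hom]
      rw [← Category.assoc, ← Category.assoc]
      exact congr($hk ≫ (Y.map (homOfLE hg₁)).hom)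
    · change x.1.2 ≫ (Y.map (k ≫ homOfLE hg₁)).hom = y.1.2 ≫ (Y.map (k ≫ homOfLE hg₁)).hom
      rw [Subsingleton.elim (k ≫ homOfLE hg₁) (l ≫ homOfLE hg₂), Y.map_comp,
        ObjectProperty.FullSubcategory.comp_hom, ← Category.assoc, ← Category.assoc]
      exact congr($hl ≫ (Y.map (homOfLE hg₂)).hom)

end

theorem isGenerator_natPresheaf (hF : IsPlus F) {A : Fp K} {τ : homFunctor L A.obj ⟶ F}
    (hτ : ∀ X, Function.Surjective (τ.app X)) :
    IsGenerator (natPresheaf F) L (natEquiv.symm τ) := by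
  intro B r
  obtain ⟨C, h, k, hh, hk⟩ := hF.exists_lift (natEquiv r) τ hτ
  refine ⟨C, h, k, hh, natEquiv.injective ?_⟩
  rw [natEquiv_map, natEquiv_map, hk, Equiv.apply_symm_apply]

/-- Morphisms of finitely presentable objects inducing the same map on the functors `Hom(-, X)`
for `X` in `L` are equalized by a morphism with respect to which the objects of `L` are
injective. -/
theorem exists_coequalizing {A B : Fp K} {f g : A ⟶ B}
    (h : homFunctorMap L f = homFunctorMap L g) :
    ∃ (C : Fp K) (q : B ⟶ C), injMorphisms L q ∧ f ≫ q = g ≫ q := by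
  obtain ⟨C, q, hq, hC⟩ := exists_coequalizer_fp f g
  exact ⟨C, q, fun X hX b ↦ hC b congr(($h).app ⟨X, hX⟩ b), hq⟩

theorem exists_cover_fiberProduct (hF : IsPlus F) {A B : Fp K} (σ : homFunctor L A.obj ⟶ F)
    (τ : homFunctor L B.obj ⟶ F) :
    ∃ (C : Fp K) (f : A ⟶ C) (g : B ⟶ C) (ρ : homFunctor L C.obj ⟶ fiberProduct σ τ),
      (∀ X, Function.Surjective (ρ.app X)) ∧ ρ ≫ fiberProduct.fst σ τ = homFunctorMap L f ∧
        ρ ≫ fiberProduct.snd σ τ = homFunctorMap L g := by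
  obtain ⟨D, ρ, hρ⟩ := (isPlus_fiberProduct σ τ hF).exists_surjective
  have hid (A : Fp K) (X) : Function.Surjective ((𝟙 (homFunctor L A.obj) :).app X) :=
    fun a ↦ ⟨a, rfl⟩
  -- A transformation `Hom(D, -) ⟶ Hom(A, -)` on `L` need not come from a morphism `A ⟶ D`. Lifting
  -- it through the identity of `Hom(A, -)` replaces `D` by a refinement where it does.
  obtain ⟨D₁, h₁, d₁, hh₁, e₁⟩ := (isPlus_homFunctor A).exists_lift
    (ρ ≫ fiberProduct.fst σ τ) (𝟙 _) (hid A)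
  obtain ⟨D₂, h₂, d₂, hh₂, e₂⟩ := (isPlus_homFunctor B).exists_lift
    (homFunctorMap L h₁ ≫ ρ ≫ fiberProduct.snd σ τ) (𝟙 _) (hid B)
  refine ⟨D₂, d₁ ≫ h₂, d₂, homFunctorMap L (h₁ ≫ h₂) ≫ ρ, fun X x ↦ ?_, ?_, ?_⟩
  · obtain ⟨a, rfl⟩ := hρ X x
    obtain ⟨b, rfl⟩ := injMorphisms_comp hh₁ hh₂ X.property a
    exact ⟨b, rfl⟩
  · rw [homFunctorMap_comp, homFunctorMap_comp, Category.assoc, Category.assoc, e₁,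
      Category.comp_id]
  · rw [homFunctorMap_comp, Category.assoc, Category.assoc, e₂, Category.comp_id]

theorem regularObjects_natSheaf (F : Plus.{w} L.FullSubcategory) :
    regularObjects.{w} (FunTopos L) ((natSheaf L).obj F) := by
  have hF := (isPlus_iff _).1 F.property
  refine ⟨?_, fun P B B' p q b b' h hB hB' ↦ ?_⟩
  · obtain ⟨A, τ, hτ⟩ := hF.exists_surjective
    exact isSupercompact_of_isGenerator (isGenerator_natPresheaf hF hτ)
  · obtain ⟨C, x, hx⟩ := exists_isGenerator hB
    obtain ⟨C', x', hx'⟩ := exists_isGenerator hB'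
    let σ : homFunctor L C.obj ⟶ F.obj := natEquiv (b.hom.app _ x)
    let σ' : homFunctor L C'.obj ⟶ F.obj := natEquiv (b'.hom.app _ x')
    have hσ {D : Fp K} (k : C ⟶ D) :
        natEquiv (b.hom.app _ (B.obj.map k.op.op x)) = homFunctorMap L k ≫ σ :=
      congr(natEquiv $(NatTrans.naturality_apply b.hom k.op.op x)).trans (natEquiv_map _ _)
    have hσ' {D : Fp K} (k : C' ⟶ D) :
        natEquiv (b'.hom.app _ (B'.obj.map k.op.op x')) = homFunctorMap L k ≫ σ' :=
      congr(natEquiv $(NatTrans.naturality_apply b'.hom k.op.op x')).trans (natEquiv_map _ _)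
    obtain ⟨D, d, d', τ, hτ, e, e'⟩ := exists_cover_fiberProduct hF σ σ'
    obtain ⟨z, hz, hz'⟩ := FunTopos.exists_of_isPullback h (B.obj.map d.op.op x)
      (B'.obj.map d'.op.op x') (by
        apply natEquiv.injective
        refine (hσ _).trans (Eq.trans ?_ (hσ' _).symm)
        rw [← e, ← e', Category.assoc, Category.assoc, fiberProduct.condition])
    have hp {A A' : Fp K} (f : A ⟶ A') (t : P.obj.obj (op (op A))) :
        p.hom.app _ (P.obj.map f.op.op t) = B.obj.map f.op.op (p.hom.app _ t) :=
      NatTrans.naturality_apply p.hom f.op.op t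
    have hq {A A' : Fp K} (f : A ⟶ A') (t : P.obj.obj (op (op A))) :
        q.hom.app _ (P.obj.map f.op.op t) = B'.obj.map f.op.op (q.hom.app _ t) :=
      NatTrans.naturality_apply q.hom f.op.op t
    refine isSupercompact_of_isGenerator (q := z) fun E y ↦ ?_
    obtain ⟨E₁, g₁, k₁, hg₁, hy₁⟩ := hx E (p.hom.app _ y)
    obtain ⟨E₂, g₂, k₂, hg₂, hy₂⟩ := hx' E₁ (q.hom.app _ (P.obj.map g₁.op.op y))
    rw [← hp] at hy₁
    rw [← hq, ← map_op_op_comp_apply] at hy₂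
    replace hy₁ := congr(B.obj.map g₂.op.op $hy₁)
    rw [← hp, ← map_op_op_comp_apply, ← map_op_op_comp_apply] at hy₁
    obtain ⟨γ, hγ, hγ'⟩ := fiberProduct.exists_lift (σ := σ) (τ := σ')
      (homFunctorMap L (k₁ ≫ g₂)) (homFunctorMap L k₂) (by
        rw [← hσ, ← hσ', ← hy₁, ← hy₂]
        exact congr(natEquiv (($(h.w)).hom.app _ (P.obj.map (g₁ ≫ g₂).op.op y))))
    obtain ⟨E₃, g₃, l, hg₃, hl⟩ := (isPlus_fiberProduct σ σ' hF).exists_lift γ τ hτ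
    -- The two morphisms are so far equal only as transformations on `L`; a further refinement makes
    -- them equal in `Fp K`, and likewise for the second projection.
    obtain ⟨E₄, q₁, hq₁, he₁⟩ := exists_coequalizing (L := L) (f := (k₁ ≫ g₂) ≫ g₃) (g := d ≫ l) (by
      rw [homFunctorMap_comp, homFunctorMap_comp d, ← e, ← hγ, ← Category.assoc, hl, Category.assoc])
    obtain ⟨E₅, q₂, hq₂, he₂⟩ := exists_coequalizing (L := L) (f := k₂ ≫ g₃) (g := d' ≫ l) (by
      rw [homFunctorMap_comp, homFunctorMap_comp d', ← e', ← hγ', ← Category.assoc, hl,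
        Category.assoc])
    obtain ⟨E₆, r₁, r₂, hr₁, hr⟩ := exists_pushout_injMorphisms L q₁ hq₁ q₂
    refine ⟨E₆, (g₁ ≫ g₂) ≫ g₃ ≫ q₂ ≫ r₁, l ≫ q₂ ≫ r₁,
      injMorphisms_comp (injMorphisms_comp hg₁ hg₂)
        (injMorphisms_comp hg₃ (injMorphisms_comp hq₂ hr₁)), ?_⟩
    refine FunTopos.ext_of_isPullback h ?_ ?_
    · rw [hp, hp, hz, map_op_op_comp_apply, ← hp, hy₁, ← map_op_op_comp_apply,
        ← map_op_op_comp_apply, hr]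
      congr 5
      simpa only [Category.assoc] using congr($he₁ ≫ r₂)
    · rw [hq, hq, hz', map_op_op_comp_apply, ← hq, hy₂, ← map_op_op_comp_apply,
        ← map_op_op_comp_apply]
      congr 5
      simpa only [Category.assoc] using congr($he₂ ≫ r₁)

end Regular

end DefinableCat

namespace DefinableCat

/-! ### Presentations of regular sheaves by a generator and one pair -/

section Presentation

variable {K : Type u} [Category.{w} K] [IsLocallyFinitelyPresentable.{w} K]
  {L : ObjectProperty K}

theorem isLocallyInjective_iff {P Q : (Fp K)ᵒᵖᵒᵖ ⥤ Type w} (f : P ⟶ Q) :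
    Presheaf.IsLocallyInjective (coverage L).toGrothendieck f ↔
      ∀ (A : Fp K) (x y : P.obj (op (op A))), f.app _ x = f.app _ y → ∃ (B : Fp K) (h : A ⟶ B),
        injMorphisms L h ∧ P.map h.op.op x = P.map h.op.op y := by
  constructor
  · intro hf A x y hxy
    exact (mem_coverage_iff _).1 (Presheaf.equalizerSieve_mem (coverage L).toGrothendieck f x y hxy)
  · intro hf
    exact ⟨fun {A} x y hxy ↦ (mem_coverage_iff _).2 (hf A.unop.unop x y hxy)⟩

/-- Two sheaves with generators that satisfy the same equations are isomorphic. -/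
theorem nonempty_iso_of_isGenerator {Q Q' : FunTopos L} {A : Fp K} {q : Q.obj.obj (op (op A))}
    {q' : Q'.obj.obj (op (op A))} (hq : IsGenerator Q.obj L q) (hq' : IsGenerator Q'.obj L q')
    (h : ∀ ⦃C : Fp K⦄ (f g : A ⟶ C), Q.obj.map f.op.op q = Q.obj.map g.op.op q ↔
      Q'.obj.map f.op.op q' = Q'.obj.map g.op.op q') : Nonempty (Q ≅ Q') := by
  let R : Subfunctor Q.obj := Subfunctor.ofSection q
  choose k hk using fun (U : (Fp K)ᵒᵖᵒᵖ) (x : R.toFunctor.obj U) ↦ x.2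
  let ρ : R.toFunctor ⟶ Q'.obj :=
    { app := fun U ↦ TypeCat.ofHom fun x ↦ Q'.obj.map (k U x) q'
      naturality := fun U V f ↦ by
        refine ConcreteCategory.hom_ext _ _ fun x ↦ ?_
        change Q'.obj.map (k V (R.toFunctor.map f x)) q' = Q'.obj.map f (Q'.obj.map (k U x) q')
        refine Eq.trans ?_ (Functor.map_comp_apply Q'.obj (k U x) f q')
        refine (h (k V (R.toFunctor.map f x)).unop.unop (k U x ≫ f).unop.unop).1 ?_
        refine (hk _ _).trans (Eq.trans ?_ (Functor.map_comp_apply Q.obj (k U x) f q).symm)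
        exact congr(Q.obj.map f $(hk U x)).symm }
  have hρ {C : Fp K} (f : A ⟶ C) (hf : Q.obj.map f.op.op q ∈ R.obj (op (op C))) :
      ρ.app _ ⟨_, hf⟩ = Q'.obj.map f.op.op q' :=
    (h (k _ ⟨_, hf⟩).unop.unop f).1 (hk _ ⟨_, hf⟩)
  -- The presheaf `R` of restrictions of `q` maps to both sheaves by locally bijective maps, which
  -- sheafification inverts.
  have h₁ : (coverage L).toGrothendieck.W R.ι := by
    rw [GrothendieckTopology.W_iff_isLocallyBijective]
    refine ⟨(isLocallyInjective_iff _).2 fun C x y hxy ↦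
      ⟨C, 𝟙 C, injMorphisms_id C, congrArg _ (Subtype.ext hxy)⟩,
      (isLocallySurjective_iff _).2 fun C r ↦ ?_⟩
    obtain ⟨D, h, k, hh, hr⟩ := hq C r
    exact ⟨D, h, ⟨_, k.op.op, rfl⟩, hh, hr.symm⟩
  have h₂ : (coverage L).toGrothendieck.W ρ := by
    rw [GrothendieckTopology.W_iff_isLocallyBijective]
    refine ⟨(isLocallyInjective_iff _).2 fun C x y hxy ↦
      ⟨C, 𝟙 C, injMorphisms_id C, congrArg _ (Subtype.ext ?_)⟩,
      (isLocallySurjective_iff _).2 fun C r ↦ ?_⟩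
    · rw [← hk _ x, ← hk _ y]
      exact (h (k _ x).unop.unop (k _ y).unop.unop).2 hxy
    · obtain ⟨D, h, k, hh, hr⟩ := hq' C r
      exact ⟨D, h, ⟨_, k.op.op, rfl⟩, hh, (hρ k _).trans hr.symm⟩
  rw [GrothendieckTopology.W_iff] at h₁ h₂
  exact ⟨sheafificationIso Q ≪≫ (asIso ((presheafToSheaf _ _).map R.ι)).symm ≪≫
    asIso ((presheafToSheaf _ _).map ρ) ≪≫ (sheafificationIso Q').symm⟩

theorem exists_presentation {Q : FunTopos L} (hQ : regularObjects.{w} (FunTopos L) Q) :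
    ∃ (A : Fp K) (q : Q.obj.obj (op (op A))) (B : Fp K) (g g' : A ⟶ B),
      IsGenerator Q.obj L q ∧ Q.obj.map g.op.op q = Q.obj.map g'.op.op q ∧
      ∀ ⦃C : Fp K⦄ (k k' : A ⟶ C), Q.obj.map k.op.op q = Q.obj.map k'.op.op q →
        ∃ (D : Fp K) (h : C ⟶ D) (l : B ⟶ D), injMorphisms L h ∧ g ≫ l = k ≫ h ∧
          g' ≫ l = k' ≫ h := by
  obtain ⟨A, q, hq⟩ := exists_isGenerator hQ.1
  let J := (coverage L).toGrothendieck
  let y : (Fp K)ᵒᵖᵒᵖ ⥤ Type w := yoneda.obj (op A)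
  let S : FunTopos L := (presheafToSheaf J (Type w)).obj y
  let φ : y ⟶ Q.obj := yonedaEquiv.symm q
  let η : y ⟶ S.obj := toSheafify J y
  let ψ : S ⟶ Q := ObjectProperty.homMk (sheafifyLift J φ Q.property)
  have hψ {C : Fp K} (k : A ⟶ C) : ψ.hom.app _ (η.app (op (op C)) k.op) = Q.obj.map k.op.op q := by
    refine Eq.trans congr(($(toSheafify_sheafifyLift J φ Q.property)).app (op (op C)) k.op) ?_
    exact yonedaEquiv_symm_app_apply _ _ _
  have hη₁ := (isLocallySurjective_iff (L := L) η).1 (inferInstanceAs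
    (Presheaf.IsLocallySurjective J (toSheafify J y)))
  have hη₂ := (isLocallyInjective_iff (L := L) η).1 (inferInstanceAs
    (Presheaf.IsLocallyInjective J (toSheafify J y)))
  have hη {C D : Fp K} (k : A ⟶ C) (f : C ⟶ D) :
      S.obj.map f.op.op (η.app (op (op C)) k.op) = η.app (op (op D)) (k ≫ f).op :=
    (NatTrans.naturality_apply η f.op.op k.op).symm
  have hS : IsSupercompact.{w} S := by
    refine isSupercompact_of_isGenerator (q := η.app (op (op A)) (𝟙 (op A))) fun B r ↦ ?_
    obtain ⟨C, h, x, hh, hx⟩ := hη₁ B r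
    refine ⟨C, h, x.unop, hh, hx.symm.trans ?_⟩
    refine Eq.trans ?_ (hη (𝟙 A) x.unop).symm
    rw [Category.id_comp]
    rfl
  -- Regularity of `Q` makes the kernel pair of `ψ` supercompact, hence generated by one section
  -- `z`. Sections of the sheafified representable `S` are only locally morphisms out of `A`, so `z`
  -- is refined twice, once for each projection.
  have hpb := IsPullback.of_hasPullback ψ ψ
  obtain ⟨B₀, z, hz⟩ := exists_isGenerator (hQ.2 _ _ _ _ hpb hS hS)
  obtain ⟨B₁, h₁, x₁, hh₁, hx₁⟩ := hη₁ B₀ ((pullback.fst ψ ψ).hom.app _ z)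
  obtain ⟨B, h₂, x₂, hh₂, hx₂⟩ := hη₁ B₁ (S.obj.map h₁.op.op ((pullback.snd ψ ψ).hom.app _ z))
  have nat {T T' : FunTopos L} (f : T ⟶ T') {C D : Fp K} (k : C ⟶ D) (t) :
      T'.obj.map k.op.op (f.hom.app _ t) = f.hom.app _ (T.obj.map k.op.op t) :=
    (NatTrans.naturality_apply f.hom k.op.op t).symm
  let z' := (pullback ψ ψ).obj.map (h₁ ≫ h₂).op.op z
  have hz' := hz.of_map (injMorphisms_comp hh₁ hh₂)
  have e₁ : (pullback.fst ψ ψ).hom.app _ z' = η.app (op (op B)) (x₁.unop ≫ h₂).op := by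
    rw [← nat, map_op_op_comp_apply, ← hx₁]
    exact hη _ _
  have e₂ : (pullback.snd ψ ψ).hom.app _ z' = η.app (op (op B)) x₂ := by
    rw [← nat, map_op_op_comp_apply, ← hx₂]
  refine ⟨A, q, B, x₁.unop ≫ h₂, x₂.unop, hq, ?_, fun C k k' hk ↦ ?_⟩
  · rw [← hψ, ← e₁, ← hψ]
    exact congr(($(hpb.w)).hom.app _ z').trans congr(ψ.hom.app _ $e₂)
  · rw [← hψ, ← hψ] at hk
    obtain ⟨t, ht, ht'⟩ := FunTopos.exists_of_isPullback hpb _ _ hk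
    obtain ⟨D, h, l, hh, hl⟩ := hz' C t
    -- Equality in `S` gives equality of morphisms only after a refinement, one for each projection.
    obtain ⟨D₁, i₁, hi₁, hi₁'⟩ := hη₂ D ((x₁.unop ≫ h₂) ≫ l).op (k ≫ h).op 
      ((hη (x₁.unop ≫ h₂) l).symm.trans (congr(S.obj.map l.op.op $e₁.symm).trans
        ((nat _ l z').trans (congr((pullback.fst ψ ψ).hom.app _ $hl.symm).trans
          ((nat _ h t).symm.trans (congr(S.obj.map h.op.op $ht).trans (hη k h)))))))
    have e₃ : η.app (op (op D)) (x₂.unop ≫ l).op = η.app (op (op D)) (k' ≫ h).op :=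
      (hη x₂.unop l).symm.trans (congr(S.obj.map l.op.op $e₂.symm).trans
        ((nat _ l z').trans (congr((pullback.snd ψ ψ).hom.app _ $hl.symm).trans
          ((nat _ h t).symm.trans (congr(S.obj.map h.op.op $ht').trans (hη k' h))))))
    obtain ⟨D₂, i₂, hi₂, hi₂'⟩ := hη₂ D₁ ((x₂.unop ≫ l) ≫ i₁).op ((k' ≫ h) ≫ i₁).op
      ((hη _ _).symm.trans (congr(S.obj.map i₁.op.op $e₃).trans (hη _ _)))
    refine ⟨D₂, h ≫ i₁ ≫ i₂, l ≫ i₁ ≫ i₂,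
      injMorphisms_comp hh (injMorphisms_comp hi₁ hi₂), ?_, ?_⟩
    · have : ((x₁.unop ≫ h₂) ≫ l) ≫ i₁ = (k ≫ h) ≫ i₁ := congr(($hi₁').unop)
      simpa only [Category.assoc] using congr($this ≫ i₂)
    · have : ((x₂.unop ≫ l) ≫ i₁) ≫ i₂ = ((k' ≫ h) ≫ i₁) ≫ i₂ := congr(($hi₂').unop)
      simpa only [Category.assoc] using this

end Presentation

end DefinableCat

namespace DefinableCat

/-! ### Quotients of `Hom(A, -)` by represented equivalence relations -/

section Quotient

variable {K : Type u} [Category.{w} K] {A B : Fp K} (g g' : A ⟶ B)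

/-- The relation on morphisms from `A` that is represented by a pair of morphisms `A ⟶ B`. -/
def pairRel (X : K) (a b : A.obj ⟶ X) : Prop :=
  ∃ l : B.obj ⟶ X, g.hom ≫ l = a ∧ g'.hom ≫ l = b

variable {g g'} in
theorem pairRel.comp {X Y : K} {a b : A.obj ⟶ X} (h : pairRel g g' X a b) (f : X ⟶ Y) :
    pairRel g g' Y (a ≫ f) (b ≫ f) := by
  obtain ⟨l, rfl, rfl⟩ := h
  exact ⟨l ≫ f, (Category.assoc _ _ _).symm, (Category.assoc _ _ _).symm⟩

variable (L : ObjectProperty K)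

/-- The quotient of a functor `Hom(A, -)` by the relation represented by a pair of morphisms. -/
def quotientFunctor : L.FullSubcategory ⥤ Type w where
  obj X := Quot (pairRel g g' X.obj)
  map f := TypeCat.ofHom (Quot.map (· ≫ f.hom) fun _ _ h ↦ h.comp f.hom)
  map_id X := by
    refine ConcreteCategory.hom_ext _ _ fun x ↦ ?_
    obtain ⟨a, rfl⟩ := Quot.exists_rep x
    exact congrArg (Quot.mk _) (Category.comp_id a)
  map_comp f h := by
    refine ConcreteCategory.hom_ext _ _ fun x ↦ ?_
    obtain ⟨a, rfl⟩ := Quot.exists_rep x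
    exact congrArg (Quot.mk _) (Category.assoc a f.hom h.hom).symm

/-- The projection onto the quotient. -/
def quotientFunctor.π : homFunctor L A.obj ⟶ quotientFunctor g g' L where
  app X := TypeCat.ofHom (Quot.mk _)

end Quotient

section IsPlus

variable {K : Type u} [Category.{w} K] [IsLocallyFinitelyPresentable.{w} K]
  {L : ObjectProperty K} [hL : Fact (IsDefinable L)] {A B : Fp K} {g g' : A ⟶ B}

/-- The witnesses of the relation are morphisms out of the finitely presentable `B`, so they
assemble over products and descend to a stage of a directed colimit, just as representatives do. -/
theorem isPlus_quotientFunctor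
    (hg : ∀ X : L.FullSubcategory, Equivalence (pairRel g g' X.obj)) :
    IsPlus (quotientFunctor g g' L) where
  existsUnique {I Y c} hc s := by
    choose a ha using fun i ↦ Quot.exists_rep (s i)
    obtain ⟨x, hx, -⟩ := homFunctor_existsUnique A.obj hc a
    refine ⟨Quot.mk _ x, fun i ↦ Eq.trans (congrArg (Quot.mk _) (hx i)) (ha i), fun y hy ↦ ?_⟩
    obtain ⟨b, rfl⟩ := Quot.exists_rep y
    choose l hl hl' using fun i ↦ ((hg _).quot_mk_eq_iff _ _).1 ((hy i).trans (ha i).symm)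
    obtain ⟨m, hm, -⟩ := homFunctor_existsUnique B.obj hc l
    refine Quot.sound ⟨m, (homFunctor_existsUnique A.obj hc fun i ↦ g.hom ≫ l i).unique
      (fun i ↦ ?_) fun i ↦ (hl i).symm, (homFunctor_existsUnique A.obj hc a).unique
      (fun i ↦ ?_) hx⟩
    · rw [Category.assoc, hm]
    · rw [Category.assoc, hm, hl']
  exists_rep {D} _ _ _ {Y c} hc x := by
    obtain ⟨a, rfl⟩ := Quot.exists_rep x
    obtain ⟨d, b, hb⟩ := (isPlus_homFunctor A).exists_rep hc a
    exact ⟨d, Quot.mk _ b, congrArg (Quot.mk _) hb⟩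
  exists_eq {D} _ _ _ {Y c} hc d x y h := by
    obtain ⟨a, rfl⟩ := Quot.exists_rep x
    obtain ⟨b, rfl⟩ := Quot.exists_rep y
    have hw {i j : D} (k : i ⟶ j) : (Y.map k).hom ≫ (c.ι.app j).hom = (c.ι.app i).hom :=
      congr(($(c.w k)).hom)
    obtain ⟨l, hl, hl'⟩ := ((hg _).quot_mk_eq_iff _ _).1 h
    obtain ⟨e₀, m₀, hm₀⟩ := (isPlus_homFunctor B).exists_rep hc l
    obtain ⟨e, hde, he⟩ := exists_ge_ge d e₀
    obtain ⟨m, hm⟩ : ∃ m : B.obj ⟶ (Y.obj e).obj, m ≫ (c.ι.app e).hom = l :=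
      ⟨m₀ ≫ (Y.map (homOfLE he)).hom, by rw [Category.assoc, hw]; exact hm₀⟩
    have key (p : A ⟶ B) (x : A.obj ⟶ (Y.obj d).obj) (hp : p.hom ≫ l = x ≫ (c.ι.app d).hom) :
        ∃ f, e ≤ f ∧ ∀ (j : D) (hj : d ⟶ j) (hj' : e ⟶ j), f ≤ j →
          p.hom ≫ m ≫ (Y.map hj').hom = x ≫ (Y.map hj).hom := by
      obtain ⟨f, k, hk⟩ := (isPlus_homFunctor A).exists_eq hc e (p.hom ≫ m)
        (x ≫ (Y.map (homOfLE hde)).hom) (by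
          change (p.hom ≫ m) ≫ (c.ι.app e).hom = (x ≫ _) ≫ (c.ι.app e).hom
          rw [Category.assoc, hm, hp, Category.assoc, hw])
      refine ⟨f, leOfHom k, fun j hj hj' hf ↦ ?_⟩
      replace hk : (p.hom ≫ m) ≫ (Y.map k).hom = (x ≫ (Y.map (homOfLE hde)).hom) ≫ (Y.map k).hom :=
        hk
      rw [Subsingleton.elim hj (homOfLE hde ≫ k ≫ homOfLE hf),
        Subsingleton.elim hj' (k ≫ homOfLE hf)]
      simp only [Functor.map_comp, ObjectProperty.FullSubcategory.comp_hom]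
      simpa only [Category.assoc] using congr($hk ≫ (Y.map (homOfLE hf)).hom)
    obtain ⟨f₁, hf₁, h₁⟩ := key g a hl
    obtain ⟨f₂, hf₂, h₂⟩ := key g' b hl'
    obtain ⟨f, hf₁', hf₂'⟩ := exists_ge_ge f₁ f₂
    have hef := hf₁.trans hf₁'
    exact ⟨f, homOfLE (hde.trans hef), Quot.sound ⟨m ≫ (Y.map (homOfLE hef)).hom,
      h₁ f _ _ hf₁', h₂ f _ _ hf₂'⟩⟩

end IsPlus

/-! ### Essential surjectivity -/

section EssSurj

variable {K : Type u} [Category.{w} K] [IsLocallyFinitelyPresentable.{w} K]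
  {L : ObjectProperty K}

theorem pairRel_of_injMorphisms {A B C D : Fp K} {g g' : A ⟶ B} {k k' : A ⟶ C} {i : C ⟶ D}
    {l : B ⟶ D} (hi : injMorphisms L i) (h₁ : g ≫ l = k ≫ i) (h₂ : g' ≫ l = k' ≫ i)
    (X : L.FullSubcategory) (c : C.obj ⟶ X.obj) :
    pairRel g g' X.obj (k.hom ≫ c) (k'.hom ≫ c) := by
  obtain ⟨d, rfl⟩ := hi X.property c
  refine ⟨l.hom ≫ d, ?_, ?_⟩
  · simpa only [Category.assoc, ObjectProperty.FullSubcategory.comp_hom] using congr(($h₁).hom ≫ d)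
  · simpa only [Category.assoc, ObjectProperty.FullSubcategory.comp_hom] using congr(($h₂).hom ≫ d)

theorem equivalence_pairRel {Q : FunTopos L} {A B : Fp K} {q : Q.obj.obj (op (op A))}
    {g g' : A ⟶ B} (hq : Q.obj.map g.op.op q = Q.obj.map g'.op.op q)
    (h : ∀ ⦃C : Fp K⦄ (k k' : A ⟶ C), Q.obj.map k.op.op q = Q.obj.map k'.op.op q →
      ∃ (D : Fp K) (h : C ⟶ D) (l : B ⟶ D), injMorphisms L h ∧ g ≫ l = k ≫ h ∧ g' ≫ l = k' ≫ h)
    (X : L.FullSubcategory) : Equivalence (pairRel g g' X.obj) := by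
  have key {C : Fp K} {k k' : A ⟶ C} (hk : Q.obj.map k.op.op q = Q.obj.map k'.op.op q)
      (c : C.obj ⟶ X.obj) : pairRel g g' X.obj (k.hom ≫ c) (k'.hom ≫ c) := by
    obtain ⟨D, i, l, hi, h₁, h₂⟩ := h k k' hk
    exact pairRel_of_injMorphisms hi h₁ h₂ X c
  refine ⟨fun a ↦ ?_, ?_, ?_⟩
  · simpa using key (k := 𝟙 A) (k' := 𝟙 A) rfl a
  · rintro _ _ ⟨l, rfl, rfl⟩
    exact key hq.symm l
  · rintro _ _ _ ⟨l, rfl, rfl⟩ ⟨m, hm, rfl⟩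
    -- The pushout carries the generic composable pair of related elements; its outer legs identify
    -- `q`, so the hypothesis relates them.
    obtain ⟨P, i, j, hij, hP⟩ := exists_pushout_fp g' g
    obtain ⟨p, rfl, rfl⟩ := hP l m hm.symm
    have := key (k := g ≫ i) (k' := g' ≫ j) (by
      rw [map_op_op_comp_apply, hq, ← map_op_op_comp_apply, hij, map_op_op_comp_apply, hq,
        ← map_op_op_comp_apply]) p
    simpa only [Category.assoc, ObjectProperty.FullSubcategory.comp_hom] using this

/-- `D` is the universal object under `B` and `C` satisfying both equations. A point of `C` extends
to `D` exactly when it makes `k` and `k'` related, which the hypothesis grants on `L`. -/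
theorem exists_injMorphisms_of_pairRel {A B C : Fp K} {g g' : A ⟶ B} {k k' : A ⟶ C}
    (h : ∀ (X : L.FullSubcategory) (c : C.obj ⟶ X.obj),
      pairRel g g' X.obj (k.hom ≫ c) (k'.hom ≫ c)) :
    ∃ (D : Fp K) (i : C ⟶ D) (l : B ⟶ D), injMorphisms L i ∧ g ≫ l = k ≫ i ∧ g' ≫ l = k' ≫ i := by
  obtain ⟨P, i, j, hij, hP⟩ := exists_pushout_fp g k
  obtain ⟨D, d, hd, hD⟩ := exists_coequalizer_fp (g' ≫ i) (k' ≫ j)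
  refine ⟨D, j ≫ d, i ≫ d, fun X hX c ↦ ?_, ?_, ?_⟩
  · obtain ⟨l, h₁, h₂⟩ := h ⟨X, hX⟩ c
    obtain ⟨p, rfl, rfl⟩ := hP l c h₁
    obtain ⟨m, rfl⟩ := hD p (by simpa using h₂)
    exact ⟨m, Category.assoc _ _ _⟩
  · rw [← Category.assoc, hij, Category.assoc]
  · rw [← Category.assoc, hd, Category.assoc]

variable [hL : Fact (IsDefinable L)]

theorem exists_natSheaf_iso {Q : FunTopos L} (hQ : regularObjects.{w} (FunTopos L) Q) :
    ∃ F : Plus.{w} L.FullSubcategory, Nonempty ((natSheaf L).obj F ≅ Q) := by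
  obtain ⟨A, q, B, g, g', hgen, hq, h⟩ := exists_presentation hQ
  have hg := equivalence_pairRel hq h
  have hF := isPlus_quotientFunctor hg
  let π := quotientFunctor.π g g' L
  refine ⟨⟨quotientFunctor g g' L, (isPlus_iff _).2 hF⟩, nonempty_iso_of_isGenerator
    (q := natEquiv.symm π) (isGenerator_natPresheaf hF fun X ↦ Quot.mk_surjective) hgen
    fun C k k' ↦ ?_⟩
  change (natPresheaf (quotientFunctor g g' L)).map k.op.op _ =
    (natPresheaf (quotientFunctor g g' L)).map k'.op.op _ ↔ _
  rw [natPresheaf_map_symm, natPresheaf_map_symm, natEquiv.symm.injective.eq_iff]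
  constructor
  · intro hk
    obtain ⟨D, i, l, hi, h₁, h₂⟩ := exists_injMorphisms_of_pairRel (L := L) (g := g) (g' := g')
      (k := k) (k' := k') fun X c ↦ ((hg X).quot_mk_eq_iff _ _).1 congr(($hk).app X c)
    refine Q.ext_of_injMorphisms hi ?_
    rw [← map_op_op_comp_apply, ← h₁, map_op_op_comp_apply, hq, ← map_op_op_comp_apply, h₂,
      map_op_op_comp_apply]
  · intro hk
    obtain ⟨D, i, l, hi, h₁, h₂⟩ := h k k' hk
    exact homFunctor_hom_ext fun X c ↦ Quot.sound (pairRel_of_injMorphisms hi h₁ h₂ X c)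

variable (L) in
/-- The functor from `L⁺` to the regular objects of the topos of sheaves. -/
noncomputable def plusToFunCat : Plus.{w} L.FullSubcategory ⥤ FunCat L :=
  ObjectProperty.lift _ (natSheaf L) regularObjects_natSheaf

instance : (plusToFunCat L).Full := inferInstanceAs (ObjectProperty.lift _ _ _).Full

instance : (plusToFunCat L).Faithful := inferInstanceAs (ObjectProperty.lift _ _ _).Faithful

instance : (plusToFunCat L).EssSurj where
  mem_essImage Q := by
    obtain ⟨F, ⟨e⟩⟩ := exists_natSheaf_iso Q.property
    exact ⟨F, ⟨ObjectProperty.isoMk _ e⟩⟩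

instance : (plusToFunCat L).IsEquivalence where

end EssSurj

/-! ### Invariance of `L⁺` under equivalence, and the theorem -/

section Invariance

variable {A : Type u} [Category.{v} A] {A' : Type u'} [Category.{v} A']

theorem preservesProductsDirectedColimits_comp (e : A ⥤ A') [e.IsEquivalence] {F : A' ⥤ Type w}
    (hF : preservesProductsDirectedColimits.{w} A' F) :
    preservesProductsDirectedColimits.{w} A (e ⋙ F) := by
  refine ⟨fun I ↦ ?_, fun D _ _ _ ↦ ?_⟩
  · have := hF.1 I
    infer_instance
  · have := hF.2 D
    infer_instance

theorem nonempty_plus_equivalence (e : A ≌ A') : Nonempty (Plus.{w} A ≌ Plus.{w} A') := by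
  let Φ : Plus.{w} A' ⥤ Plus.{w} A := ObjectProperty.lift _
    (ObjectProperty.ι _ ⋙ (Functor.whiskeringLeft _ _ _).obj e.functor)
    fun F ↦ preservesProductsDirectedColimits_comp e.functor F.property
  have : ((Functor.whiskeringLeft _ _ (Type w)).obj e.functor).IsEquivalence :=
    (e.congrLeft (E := Type w)).isEquivalence_inverse
  have : Φ.Full := inferInstanceAs (ObjectProperty.lift _ _ _).Full
  have : Φ.Faithful := inferInstanceAs (ObjectProperty.lift _ _ _).Faithful
  have : Φ.EssSurj :=
    { mem_essImage F := ⟨⟨e.inverse ⋙ F.obj,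
        preservesProductsDirectedColimits_comp e.inverse F.property⟩,
        ⟨ObjectProperty.isoMk _ (e.funInvIdAssoc F.obj)⟩⟩ }
  have : Φ.IsEquivalence := { }
  exact ⟨Φ.asEquivalence.symm⟩

end Invariance

end DefinableCat

theorem theorem5p2p1 (K : Type u) [Category.{w} K] [IsLocallyFinitelyPresentable.{w} K]
    (L : ObjectProperty K) (hL : DefinableCat.IsDefinable L) :
    Nonempty (DefinableCat.FunCat L ≌ DefinableCat.Plus.{w} L.FullSubcategory) ∧
    ∀ (K' : Type u') [Category.{w} K'] [IsLocallyFinitelyPresentable.{w} K']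
      (L' : ObjectProperty K'), DefinableCat.IsDefinable L' →
      Nonempty (L.FullSubcategory ≌ L'.FullSubcategory) →
      Nonempty (DefinableCat.FunCat L ≌ DefinableCat.FunCat L') := by
  have : Fact (DefinableCat.IsDefinable L) := ⟨hL⟩
  refine ⟨⟨(DefinableCat.plusToFunCat L).asEquivalence.symm⟩, fun K' _ _ L' hL' ⟨e⟩ ↦ ?_⟩
  have : Fact (DefinableCat.IsDefinable L') := ⟨hL'⟩
  obtain ⟨e'⟩ := DefinableCat.nonempty_plus_equivalence.{w} e
  exact ⟨(DefinableCat.plusToFunCat L).asEquivalence.symm.trans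
    (e'.trans (DefinableCat.plusToFunCat L').asEquivalence)⟩
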